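/- **Setting.** Consider a finite two-player zero-sum partially observable Markov game with horizon $H$: layers $h=1,\dots,H$ with finite state sets $\mathcal S_h$, infosets $x_h=x(s_h)\in\mathcal X_h$ of the max-player and $y_h=y(s_h)\in\mathcal Y_h$ of the min-player, finite action sets $\mathcal A,\mathcal B$, initial distribution $p_0$, transition probabilities $p_h(s_{h+1}\mid s_h,a_h,b_h)$, and random rewards $r_h(s_h,a_h,b_h)\in[0,1]$ with mean $\bar r_h$. The game has tree structure (each state has a unique history of states and actions) and perfect recall (each infoset has a unique history of own infosets and own actions). Put $A=|\mathcal A|$, $X=\sum_{h}|\mathcal X_h|$, and let $\Pi_{\max}$ be the set of policies $\mu=\{\mu_h(\cdot\mid x_h)\}$ of the max-player. Along the unique histories, let $\mu_{1:h}(x_h,a_h)=\prod_{h'\le h}\mu_{h'}(a_{h'}\mid x_{h'})$, similarly $\nu_{1:h}(y_h,b_h)$ for the min-player, and $p_{1:h}(s_h)=p_0(s_1)\prod_{h'<h}p_{h'}(s_{h'+1}\mid s_{h'},a_{h'},b_{h'})$. Write $\langle\mu,\ell\rangle=\sum_{h}\sum_{x_h,a_h}\mu_{1:h}(x_h,a_h)\,\ell_h(x_h,a_h)$.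 For $h\le H$, the balanced exploration policy $\mu^{\star,h}$ plays $\mu^{\star,h}_{h'}(a\mid x_{h'})=|\mathcal C_h(x_{h'},a)|/|\mathcal C_h(x_{h'})|$ for $h'<h$, where $\mathcal C_h(x_{h'},a)$ is the set of infosets of layer $h$ reachable from $(x_{h'},a)$ and $\mathcal C_h(x_{h'})=\bigcup_a\mathcal C_h(x_{h'},a)$, and it plays uniformly for $h'\ge h$. **Algorithm (Balanced CFR with Regret Matching).** Start with $\mu^1_h(a\mid x_h)=1/A$. In round $t=1,\dots,T$ the opponent fixes a policy $\nu^t$, which may depend on everything that happened before round $t$ (including $\mu^t$). For $h=1,\dots,H$ the max-player plays one episode against $\nu^t$ with the policy that uses $\mu^{\star,h}$ in layers $1,\dots,h$ and $\mu^t$ in layers $h+1,\dots,H$, observes the trajectory $(x^{t,h}_k,a^{t,h}_k,r^{t,h}_k)_{k\le H}$, and sets $$\widetilde L^t_h(x_h,a_h)=\frac{\mathbf 1\{(x^{t,h}_h,a^{t,h}_h)=(x_h,a_h)\}}{\mu^{\star,h}_{1:h}(x_h,a_h)}\Bigl(H-h+1-\sum_{h'=h}^H r^{t,h}_{h'}\Bigr).$$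 Then, for all $(h,x_h)$, $$\mu^{t+1}_h(a\mid x_h)=\frac{[R^t_{x_h}(a)]_+}{\sum_{a'}[R^t_{x_h}(a')]_+},\qquad R^t_{x_h}(a)=\sum_{\tau=1}^t\Bigl(\sum_{a'}\mu^\tau_h(a'\mid x_h)\widetilde L^\tau_h(x_h,a')-\widetilde L^\tau_h(x_h,a)\Bigr),$$ with $\mu^{t+1}_h(\cdot\mid x_h)$ uniform if $[R^t_{x_h}(a)]_+=0$ for all $a$. **Theorem.** Let $\ell^t_h(x_h,a_h)=\sum_{s_h:\,x(s_h)=x_h}\sum_{b_h}p_{1:h}(s_h)\,\nu^t_{1:h}(y(s_h),b_h)\,(1-\bar r_h(s_h,a_h,b_h))$. There is an absolute constant $C>0$ such that for every such game, every opponent as above, every $T$ and every $\delta\in(0,1)$, with probability at least $1-\delta$, $$\max_{\mu^\dagger\in\Pi_{\max}}\sum_{t=1}^T\langle\mu^t-\mu^\dagger,\ell^t\rangle\le C\sqrt{H^3XA^2T\iota},\qquad \iota=\log(10XA/\delta).$$ Further, each round plays $H$ episodes, so that $HT$ episodes are played in total. -/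

import Mathlib

open MeasureTheory ProbabilityTheory Finset

noncomputable section

/-- Families `μ_h(a | x_h)`, one real number for each layer `h`, infoset `x_h` and action `a`.
Layers are numbered from `0`, so that the layers of a game with horizon `H` are `0, …, H - 1`. -/
abbrev Strategy (X : ℕ → Type*) (A : Type*) := ∀ h : ℕ, X h → A → ℝ

/-- `μ` is a policy: at every infoset of the layers `0, …, H - 1` it is a probability
distribution over the actions. -/
def IsPolicy (H : ℕ) {X : ℕ → Type*} {A : Type*} [Fintype A] (μ : Strategy X A) : Prop :=
  ∀ h < H, ∀ x : X h, μ h x ∈ stdSimplex ℝ A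

/-- The sequence form `μ_{1:h}(x_h, a_h) = ∏_{h' ≤ h} μ_{h'}(a_{h'} | x_{h'})`, the product along
the unique history of `x_h`; `prev x_{h+1} = (x_h, a_h)` is the last step of that history. -/
def seqForm {X : ℕ → Type*} {A : Type*} (prev : ∀ h, X (h + 1) → X h × A) (μ : Strategy X A) :
    Strategy X A
  | 0, x, a => μ 0 x a
  | h + 1, x, a => seqForm prev μ h (prev h x).1 (prev h x).2 * μ (h + 1) x a

/-- A two-player zero-sum partially observable Markov game with horizon `H`, tree structure and
perfect recall. `S h`, `X h`, `Y h` are the states, the infosets of the max-player and the infosets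
of the min-player in layer `h`. Only the layers `h < H` belong to the game (the types `S h`, `X h`,
`Y h` with `H ≤ h` play no role and may be empty). -/
structure POMG (H : ℕ) (S X Y : ℕ → Type*) (A B : Type*) [∀ h, Fintype (S h)] where
  /-- the emission function of the max-player -/
  obsX : ∀ h, S h → X h
  /-- the emission function of the min-player -/
  obsY : ∀ h, S h → Y h
  /-- every infoset contains a state -/
  obsX_surjective : ∀ h, Function.Surjective (obsX h)
  obsY_surjective : ∀ h, Function.Surjective (obsY h)
  /-- the distribution of the initial state -/
  init : S 0 → ℝ
  init_mem : init ∈ stdSimplex ℝ (S 0)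
  /-- the transition probabilities `p_h(s_{h+1} | s_h, a_h, b_h)` -/
  trans : ∀ h, S h → A → B → S (h + 1) → ℝ
  trans_mem : ∀ h, h + 1 < H → ∀ s a b, trans h s a b ∈ stdSimplex ℝ (S (h + 1))
  /-- the law of the random reward `r_h(s_h, a_h, b_h)` -/
  reward : ∀ h, S h → A → B → ProbabilityMeasure ℝ
  reward_mem : ∀ h s a b, (reward h s a b : Measure ℝ) (Set.Icc 0 1) = 1
  /-- tree structure: `prevS s_{h+1} = (s_h, a_h, b_h)` is the last step of the history
  of `s_{h+1}` -/
  prevS : ∀ h, S (h + 1) → S h × A × B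
  /-- no other state and actions can lead to `s_{h+1}` -/
  prevS_unique : ∀ h s a b s', trans h s a b s' ≠ 0 → prevS h s' = (s, a, b)
  /-- perfect recall of the max-player: `prevX x_{h+1} = (x_h, a_h)` is the last step of the
  history of `x_{h+1}` -/
  prevX : ∀ h, X (h + 1) → X h × A
  /-- it is the same for all states in the infoset -/
  prevX_unique : ∀ h s', prevX h (obsX (h + 1) s') = (obsX h (prevS h s').1, (prevS h s').2.1)
  /-- perfect recall of the min-player -/
  prevY : ∀ h, Y (h + 1) → Y h × B
  prevY_unique : ∀ h s', prevY h (obsY (h + 1) s') = (obsY h (prevS h s').1, (prevS h s').2.2)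

namespace POMG

variable {H : ℕ} {S X Y : ℕ → Type*} {A B : Type*} [∀ h, Fintype (S h)] [∀ h, Fintype (X h)]
  [Fintype A] [Fintype B]

/-! ### Losses -/

/-- The mean reward. -/
def meanReward (G : POMG H S X Y A B) (h : ℕ) (s : S h) (a : A) (b : B) : ℝ :=
  ∫ r, r ∂(G.reward h s a b : Measure ℝ)

/-- The sequence-form transition probability `p_{1:h}(s_h)`. -/
def seqTrans (G : POMG H S X Y A B) : ∀ h, S h → ℝ
  | 0, s => G.init s
  | h + 1, s => G.seqTrans h (G.prevS h s).1 *
      G.trans h (G.prevS h s).1 (G.prevS h s).2.1 (G.prevS h s).2.2 s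

open Classical in
/-- The loss function `ℓ_h(x_h, a_h)` against the opponent's policy `ν`. -/
def loss (G : POMG H S X Y A B) (ν : Strategy Y B) (h : ℕ) (x : X h) (a : A) : ℝ :=
  ∑ s : S h with G.obsX h s = x, ∑ b : B,
    G.seqTrans h s * seqForm G.prevY ν h (G.obsY h s) b * (1 - G.meanReward h s a b)

/-- The pairing `⟨μ, ℓ⟩` over the sequence form. -/
def pairing (G : POMG H S X Y A B) (μ : Strategy X A) (l : ∀ h, X h → A → ℝ) : ℝ :=
  ∑ h ∈ range H, ∑ x : X h, ∑ a : A, seqForm G.prevX μ h x a * l h x a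

/-- The total number `∑_h X_h` of infosets of the max-player. -/
def numInfosets (_G : POMG H S X Y A B) : ℕ := ∑ h ∈ range H, Fintype.card (X h)

/-! ### Balanced exploration policies -/

/-- `G.Reach x a k x'`: the infoset `x'` in layer `k` is a descendant of `(x, a)`. -/
inductive Reach (G : POMG H S X Y A B) {h : ℕ} (x : X h) (a : A) : (k : ℕ) → X k → Prop
  | child (x' : X (h + 1)) : G.prevX h x' = (x, a) → Reach G x a (h + 1) x'
  | step (k : ℕ) (x' : X (k + 1)) : Reach G x a k (G.prevX k x').1 → Reach G x a (k + 1) x'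

open Classical in
/-- `C_k(x_h, a_h)`, the infosets in layer `k` that are reachable from `(x_h, a_h)`. -/
def descAct (G : POMG H S X Y A B) (k : ℕ) {h : ℕ} (x : X h) (a : A) : Finset (X k) :=
  {x' | G.Reach x a k x'}

open Classical in
/-- `C_k(x_h) = ⋃_a C_k(x_h, a)`. -/
def desc (G : POMG H S X Y A B) (k : ℕ) {h : ℕ} (x : X h) : Finset (X k) :=
  univ.biUnion fun a : A => G.descAct k x a

/-- The balanced exploration policy `μ^{⋆,h}` for layer `h`. -/
def balanced (G : POMG H S X Y A B) (h : ℕ) : Strategy X A := fun k x a =>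
  if k < h then ((G.descAct h x a).card : ℝ) / ((G.desc h x).card : ℝ)
  else 1 / (Fintype.card A : ℝ)

/-- The sampling policy `μ^{⋆,h}_{1:h} μ_{h+1:H}`: it follows `μ^{⋆,h}` up to and including
layer `h`, and `μ` in the later layers. -/
def mix (G : POMG H S X Y A B) (h : ℕ) (μ : Strategy X A) : Strategy X A := fun k x a =>
  if k ≤ h then G.balanced h k x a else μ k x a

/-! ### Episodes -/

end POMG

/-- The states and actions `(s_h, a_h, b_h)_h` of an episode. -/
abbrev StatePath (H : ℕ) (S : ℕ → Type*) (A B : Type*) := (k : Fin H) → S k × A × B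

/-- What the max-player observes of an episode: `(x_h, a_h, r_h)_h`. -/
abbrev Obs (H : ℕ) (X : ℕ → Type*) (A : Type*) := (k : Fin H) → X k × A × ℝ

namespace POMG

variable {H : ℕ} {S X Y : ℕ → Type*} {A B : Type*} [∀ h, Fintype (S h)] [∀ h, Fintype (X h)]
  [Fintype A] [Fintype B]

/-- The probability with which the environment moves to the state `s_k` of the path `z`, given the
steps of `z` before layer `k`. -/
def enter (G : POMG H S X Y A B) (z : StatePath H S A B) : (k : ℕ) → k < H → ℝ
  | 0, hk => G.init (z ⟨0, hk⟩).1
  | k + 1, hk => G.trans k (z ⟨k, Nat.lt_of_succ_lt hk⟩).1 (z ⟨k, Nat.lt_of_succ_lt hk⟩).2.1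
      (z ⟨k, Nat.lt_of_succ_lt hk⟩).2.2 (z ⟨k + 1, hk⟩).1

/-- The probability that an episode played with `μ × ν` follows the path `z`: in each layer, the
environment draws the state, and the players draw their actions independently, given their
infosets. -/
def pathProb (G : POMG H S X Y A B) (μ : Strategy X A) (ν : Strategy Y B) (z : StatePath H S A B) : ℝ :=
  ∏ k : Fin H, (G.enter z k k.2 * μ k (G.obsX k (z k).1) (z k).2.1 *
    ν k (G.obsY k (z k).1) (z k).2.2)

/-- The law of the rewards `(r_h)_h` of an episode that follows the path `z`: the rewards are
independent and `r_h` has the law belonging to `(s_h, a_h, b_h)`. -/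
def rewardLaw (G : POMG H S X Y A B) (z : StatePath H S A B) : Measure (Fin H → ℝ) :=
  Measure.pi fun k : Fin H => (G.reward k (z k).1 (z k).2.1 (z k).2.2 : Measure ℝ)

/-- The max-player's trajectory `(x_h, a_h, r_h)_h` in an episode. -/
def observe (G : POMG H S X Y A B) (z : StatePath H S A B) (r : Fin H → ℝ) : Obs H X A :=
  fun k => (G.obsX k (z k).1, (z k).2.1, r k)

/-! ### Balanced CFR with Regret Matching -/

open Classical in
/-- The estimator of the counterfactual loss at `(x_h, a_h)` from the observed trajectory `o`,
`𝟙{(x_h, a_h) visited} / μ^{⋆,h}_{1:h}(x_h, a_h) * ∑_{k ≥ h} (1 - r_k)`. Since layers are numbered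
from `0`, there are `H - h` layers `k ≥ h`. -/
def lossEst (G : POMG H S X Y A B) (o : Obs H X A) (h : ℕ) (x : X h) (a : A) : ℝ :=
  if hh : h < H then
    (if (o ⟨h, hh⟩).1 = x ∧ (o ⟨h, hh⟩).2.1 = a then 1 else 0) /
        seqForm G.prevX (G.balanced h) h x a *
      ((H : ℝ) - (h : ℝ) - ∑ k : Fin H with h ≤ k.1, (o k).2.2)
  else 0

end POMG

/-- Regret Matching: play proportionally to the positive parts of the cumulative regrets `R`, and
uniformly if none of them is positive. -/
def regretMatching {A : Type*} [Fintype A] (R : A → ℝ) (a : A) : ℝ :=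
  open Classical in
  if ∀ a', R a' ≤ 0 then 1 / (Fintype.card A : ℝ)
  else max (R a) 0 / ∑ a', max (R a') 0

namespace POMG

variable {H : ℕ} {S X Y : ℕ → Type*} {A B : Type*} [∀ h, Fintype (S h)] [∀ h, Fintype (X h)]
  [Fintype A] [Fintype B]

/-- The cumulative regrets of all the local regret minimizers after `t` rounds of Balanced CFR with
Regret Matching, where `o t h` is the trajectory observed in episode `h` of round `t`. Rounds and
the episodes of a round are numbered from `0`. -/
def cfrRegret (G : POMG H S X Y A B) (o : ℕ → ℕ → Obs H X A) : ℕ → ∀ h, X h → A → ℝ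
  | 0 => fun _ _ _ => 0
  | t + 1 => fun h x a => G.cfrRegret o t h x a +
      ((∑ a', regretMatching (G.cfrRegret o t h x) a' * G.lossEst (o t h) h x a') -
        G.lossEst (o t h) h x a)

/-- The policy `μ^t` maintained by Balanced CFR with Regret Matching in round `t`. It is uniform in
round `0`, since all regrets are `0` then. -/
def cfrPolicy (G : POMG H S X Y A B) (o : ℕ → ℕ → Obs H X A) (t : ℕ) : Strategy X A :=
  fun h x => regretMatching (G.cfrRegret o t h x)

/-- The policies with which Balanced CFR plays the episodes of a round in which it maintains `μ`,
one episode for each entry. -/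
def roundPolicies (G : POMG H S X Y A B) (μ : Strategy X A) : List (Strategy X A) :=
  (List.range H).map fun h => G.mix h μ

/-- The policies with which Balanced CFR with Regret Matching plays all its episodes in the first
`T` rounds, in the order in which they are played. -/
def playedPolicies (G : POMG H S X Y A B) (o : ℕ → ℕ → Obs H X A) (T : ℕ) :
    List (Strategy X A) :=
  (List.range T).flatMap fun t => G.roundPolicies (G.cfrPolicy o t)

/-- The trajectories observed by the max-player when the episodes run as in `path` and `rew`. -/
def observations {Ω : Type*} (G : POMG H S X Y A B) (path : ℕ → ℕ → Ω → StatePath H S A B)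
    (rew : ℕ → ℕ → Ω → Fin H → ℝ) (ω : Ω) : ℕ → ℕ → Obs H X A :=
  fun t h => G.observe (path t h ω) (rew t h ω)

/-- `T` rounds in which the max-player runs Balanced CFR with Regret Matching against an arbitrary
adaptive opponent. The σ-algebra `𝓕 t` is the information of the opponent before round `t`: it
contains all that happened in the earlier rounds, and possibly more, such as private randomness of
the opponent. `path t h` and `rew t h` are the states and actions, and the rewards, in episode `h`
of round `t`. -/
structure IsCFRPlay {Ω : Type*} [mΩ : MeasurableSpace Ω] (P : Measure Ω) (T : ℕ)
    (G : POMG H S X Y A B) (𝓕 : Filtration ℕ mΩ) (ν : ℕ → Ω → Strategy Y B)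
    (path : ℕ → ℕ → Ω → StatePath H S A B) (rew : ℕ → ℕ → Ω → Fin H → ℝ) : Prop where
  /-- the opponent's choice for round `t` is a policy, chosen before the round starts -/
  isPolicy : ∀ t < T, ∀ ω, IsPolicy H (ν t ω)
  measurable_opponent : ∀ t < T, ∀ h < H, ∀ y b, Measurable[𝓕 t] fun ω => ν t ω h y b
  /-- the episodes of round `t` are over before round `t + 1` -/
  measurable_path : ∀ t < T, ∀ h < H, ∀ z, MeasurableSet[𝓕 (t + 1)] {ω | path t h ω = z}
  measurable_rew : ∀ t < T, ∀ h < H, Measurable[𝓕 (t + 1)] (rew t h)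
  /-- given the information before round `t`, episode `h` of the round is distributed as an episode
  in which the max-player uses the policy of index `h` in `roundPolicies` and the opponent
  uses `ν t`; nothing is required of the dependence between the episodes of one round -/
  law : ∀ t < T, ∀ (h : ℕ) (hh : h < H) (z : StatePath H S A B) (E : Set (Fin H → ℝ)),
    MeasurableSet E →
      P[{ω | path t h ω = z ∧ rew t h ω ∈ E}.indicator (fun _ => (1 : ℝ)) | 𝓕 t] =ᵐ[P]
        fun ω => G.pathProb
            ((G.roundPolicies (G.cfrPolicy (G.observations path rew ω) t))[h]'(by
              simpa [roundPolicies] using hh)) (ν t ω) z *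
          (G.rewardLaw z).real E

end POMG

end

/-! Telescope over the hybrids that follow the comparator `μ'` in the first `h` layers and `μ`
afterwards. The regret in one round becomes a sum over infosets of local regrets with respect to the
counterfactual losses `cfLoss`, weighted by `μ'_{1:h-1}(x)` (`pairing_sub_pairing`). The estimator
at `x` is conditionally unbiased for `cfLoss` (`condExp_lossEst`) and almost surely lies in `[0,
K_x]` with `K_x = H A / μ^{⋆,h}_{1:h-1}(x)`.

At a fixed infoset, Blackwell's argument bounds the squared positive regret on the estimates by the
sum of squared instantaneous regrets (`sum_sq_regret_le`). Since the estimates are nonnegative and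
at most `K_x`, these squares cost only `K_x` times first moments (`sum_sq_sub_le`). Multiplicative
tail bounds (`measure_sum_gt_le`, `measure_sum_lt_le`) exchange estimated for true losses at
relative error `η` and additive error `K_x ι / η`. They are needed for each single action and for
the average under the played policy, hence for `A + 2` events per infoset. None of these events
involves `μ'`, so the maximum over comparators needs no further union bound.

When the local bounds are summed, the terms proportional to `η` are expected losses of genuine
policies, at most `4 η H T` per layer. The terms proportional to `K_x` are controlled by the
balancing property `sum_seqPre_div_balanced_le`: `∑ μ'_{1:h-1}(x) / μ^{⋆,h}_{1:h-1}(x) ≤ X_h` for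
every policy `μ'`. With `b = √(H³XA²Tι)`, the choice `η = b / (H² T)` balances the two kinds of
terms. If `b ≥ H T`, the bound is trivial. -/

noncomputable section

set_option linter.unusedSectionVars false

/-! ### Sequence forms -/

section SeqForm

variable {X : ℕ → Type*} {A : Type*}

/-- The part `μ_{1:h-1}(x_h)` of the sequence form that belongs to the layers before `h`. -/
def seqPre (prev : ∀ h, X (h + 1) → X h × A) (μ : Strategy X A) : ∀ h, X h → ℝ
  | 0, _ => 1
  | h + 1, x => seqForm prev μ h (prev h x).1 (prev h x).2

/-- The strategy that follows `μ'` in the layers before `h` and `μ` from layer `h` on. -/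
def hybrid (h : ℕ) (μ' μ : Strategy X A) : Strategy X A := fun k => if k < h then μ' k else μ k

open Classical in
/-- The factors of `μ_{h+1:k}(x_k, a_k) 𝟙{(x, a) precedes (x_k, a_k)}`, for `(x, a)` in layer `h`. -/
def branch (μ : Strategy X A) (h : ℕ) (x : X h) (a : A) : Strategy X A :=
  Function.update (hybrid h (fun _ _ _ => 1) μ) h fun x' a' => if x' = x ∧ a' = a then 1 else 0

open Classical in
/-- The strategy `μ`, restricted to the trajectories through `(x, a)`. -/
def through (μ : Strategy X A) (h : ℕ) (x : X h) (a : A) : Strategy X A :=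
  Function.update μ h fun x' a' => μ h x' a' * if x' = x ∧ a' = a then 1 else 0

variable (prev : ∀ h, X (h + 1) → X h × A)

lemma seqForm_eq_seqPre_mul (μ : Strategy X A) (h : ℕ) (x : X h) (a : A) :
    seqForm prev μ h x a = seqPre prev μ h x * μ h x a := by
  cases h <;> simp [seqForm, seqPre]

lemma seqForm_congr {μ μ' : Strategy X A} {h : ℕ} (e : ∀ j ≤ h, μ j = μ' j) :
    seqForm prev μ h = seqForm prev μ' h := by
  induction h with
  | zero => funext x a; simp [seqForm, e 0 le_rfl]
  | succ h ih =>
    funext x a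
    simp [seqForm, e (h + 1) le_rfl, ih fun j hj => e j (by omega)]

lemma seqPre_congr {μ μ' : Strategy X A} {h : ℕ} (e : ∀ j < h, μ j = μ' j) :
    seqPre prev μ h = seqPre prev μ' h := by
  cases h with
  | zero => rfl
  | succ h => funext x; simp [seqPre, seqForm_congr prev (h := h) fun j hj => e j (by omega)]

lemma seqForm_nonneg {μ : Strategy X A} {h : ℕ} (e : ∀ j ≤ h, ∀ x a, 0 ≤ μ j x a) (x : X h) (a : A) :
    0 ≤ seqForm prev μ h x a := by
  induction h generalizing a with
  | zero => exact e 0 le_rfl x a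
  | succ h ih => exact mul_nonneg (ih (fun j hj => e j (by omega)) _ _) (e _ le_rfl _ _)

lemma seqPre_nonneg {μ : Strategy X A} {h : ℕ} (e : ∀ j < h, ∀ x a, 0 ≤ μ j x a) (x : X h) :
    0 ≤ seqPre prev μ h x := by
  cases h with
  | zero => exact zero_le_one
  | succ h => exact seqForm_nonneg prev (fun j hj => e j (by omega)) _ _

lemma seqForm_pos {μ : Strategy X A} {h : ℕ} (e : ∀ j ≤ h, ∀ x a, 0 < μ j x a) (x : X h) (a : A) :
    0 < seqForm prev μ h x a := by
  induction h generalizing a with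
  | zero => exact e 0 le_rfl x a
  | succ h ih => exact mul_pos (ih (fun j hj => e j (by omega)) _ _) (e _ le_rfl _ _)

lemma seqPre_pos {μ : Strategy X A} {h : ℕ} (e : ∀ j < h, ∀ x a, 0 < μ j x a) (x : X h) :
    0 < seqPre prev μ h x := by
  cases h with
  | zero => exact zero_lt_one
  | succ h => exact seqForm_pos prev (fun j hj => e j (by omega)) _ _

lemma seqPre_one (h : ℕ) (x : X h) : seqPre prev (fun _ _ _ => 1) h x = 1 := by
  have : ∀ k y b, seqForm prev (fun _ _ _ => 1) k y b = 1 := fun k => by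
    induction k with
    | zero => intro _ _; rfl
    | succ k ih => intro y b; simp [seqForm, ih]
  cases h with
  | zero => rfl
  | succ h => exact this _ _ _

lemma branch_apply_of_gt (μ : Strategy X A) {h : ℕ} (x : X h) (a : A) {k : ℕ} (hk : h < k) :
    branch μ h x a k = μ k := by
  simp [branch, Function.update_of_ne hk.ne', hybrid, hk.le.not_gt]

lemma through_apply_of_ne (μ : Strategy X A) {h : ℕ} (x : X h) (a : A) {k : ℕ} (hk : k ≠ h) :
    through μ h x a k = μ k := by
  simp [through, Function.update_of_ne hk]

open Classical in
lemma seqForm_branch_self (μ : Strategy X A) (h : ℕ) (x x' : X h) (a a' : A) :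
    seqForm prev (branch μ h x a) h x' a' = if x' = x ∧ a' = a then 1 else 0 := by
  rw [seqForm_eq_seqPre_mul, seqPre_congr prev (μ' := fun _ _ _ => 1), seqPre_one]
  · simp [branch]
  · intro j hj
    simp [branch, Function.update_of_ne hj.ne, hybrid, hj]

lemma seqForm_branch_nonneg {μ : Strategy X A} {h k : ℕ} (e : ∀ j ≤ k, ∀ x a, 0 ≤ μ j x a)
    (x : X h) (a : A) (x' : X k) (a' : A) : 0 ≤ seqForm prev (branch μ h x a) k x' a' := by
  refine seqForm_nonneg prev (fun j hj y b => ?_) x' a'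
  rcases lt_trichotomy j h with hjh | rfl | hjh
  · simp [branch, Function.update_of_ne hjh.ne, hybrid, hjh]
  · simp only [branch, Function.update_self]; split_ifs <;> simp
  · rw [branch_apply_of_gt _ _ _ hjh]; exact e j hj y b

-- The probability of passing through `(x, a)` splits off as a factor. Dividing by it is the
-- importance weighting of the estimators, and `branch` is what remains.
lemma seqForm_through (μ : Strategy X A) (h : ℕ) (x : X h) (a : A) {k : ℕ} (hk : h ≤ k) (x' : X k)
    (a' : A) : seqForm prev (through μ h x a) k x' a' =
      seqForm prev μ h x a * seqForm prev (branch μ h x a) k x' a' := by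
  classical
  induction k, hk using Nat.le_induction generalizing a' with
  | base =>
    rw [seqForm_branch_self, seqForm_eq_seqPre_mul,
      seqPre_congr prev (μ' := μ) fun j hj => through_apply_of_ne μ x a hj.ne]
    simp only [through, Function.update_self]
    split_ifs with e
    · rw [e.1, e.2, seqForm_eq_seqPre_mul]; ring
    · simp
  | succ k hk ih =>
    simp only [seqForm]
    rw [ih, through_apply_of_ne _ _ _ (by omega), branch_apply_of_gt _ _ _ (by omega)]
    ring

/-- By perfect recall a single `(x, a)` of layer `h` precedes `(x', a')`, so one term survives: `ρ`
up to layer `h`, then `μ`. -/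
lemma sum_seqForm_mul_branch [∀ h, Fintype (X h)] [Fintype A] (ρ μ : Strategy X A) (h : ℕ) {k : ℕ}
    (hk : h ≤ k) (x' : X k) (a' : A) :
    ∑ x : X h, ∑ a : A, seqForm prev ρ h x a * seqForm prev (branch μ h x a) k x' a' =
      seqForm prev (hybrid (h + 1) ρ μ) k x' a' := by
  classical
  induction k, hk using Nat.le_induction generalizing a' with
  | base =>
    rw [seqForm_congr prev (μ := hybrid (h + 1) ρ μ) (μ' := ρ) fun j hj => by
      simp [hybrid, Nat.lt_succ_of_le hj]]
    simp only [seqForm_branch_self, mul_ite, mul_one, mul_zero, ite_and]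
    simp
  | succ k hk ih =>
    simp only [seqForm, ← ih, sum_mul]
    refine sum_congr rfl fun x _ => sum_congr rfl fun a _ => ?_
    rw [branch_apply_of_gt _ _ _ (by omega)]
    simp only [hybrid, show ¬ k + 1 < h + 1 by omega, if_false]
    ring

end SeqForm

/-! ### Distribution of the steps of an episode -/

namespace POMG

variable {H : ℕ} {S X Y : ℕ → Type*} {A B : Type*} [∀ h, Fintype (S h)] [Fintype A] [Fintype B]

/-- The first `n` layers of a game with `n + 1` layers. -/
def truncate {n : ℕ} (G : POMG (n + 1) S X Y A B) : POMG n S X Y A B :=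
  { G with trans_mem := fun h hh => G.trans_mem h (Nat.lt_succ_of_lt hh) }

lemma seqTrans_truncate {n : ℕ} (G : POMG (n + 1) S X Y A B) (h : ℕ) (s : S h) :
    G.truncate.seqTrans h s = G.seqTrans h s := by
  induction h with
  | zero => rfl
  | succ h ih => simp only [seqTrans, ih]; simp [truncate]

/-- The path `z`, continued by the step `v`. -/
def extend {n : ℕ} (z : StatePath n S A B) (v : S n × A × B) : StatePath (n + 1) S A B :=
  Fin.snocEquiv (fun k : Fin (n + 1) => S k × A × B) (v, z)

@[simp] lemma extend_last {n : ℕ} (z : StatePath n S A B) (v : S n × A × B) :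
    extend z v (Fin.last n) = v :=
  Fin.snoc_last (α := fun k : Fin (n + 1) => S k × A × B) v z

@[simp] lemma extend_castSucc {n : ℕ} (z : StatePath n S A B) (v : S n × A × B) (k : Fin n) :
    extend z v k.castSucc = z k :=
  Fin.snoc_castSucc (α := fun k : Fin (n + 1) => S k × A × B) v z k

lemma extend_of_lt {n : ℕ} (z : StatePath n S A B) (v : S n × A × B) (k : ℕ) (hk : k < n) :
    extend z v ⟨k, Nat.lt_succ_of_lt hk⟩ = z ⟨k, hk⟩ :=
  extend_castSucc z v ⟨k, hk⟩

lemma sum_extend {n : ℕ} (f : StatePath (n + 1) S A B → ℝ) :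
    ∑ z, f z = ∑ z : StatePath n S A B, ∑ v : S n × A × B, f (extend z v) := by
  rw [sum_comm, ← Fintype.sum_prod_type']
  exact (Equiv.sum_comp (Fin.snocEquiv (fun k : Fin (n + 1) => S k × A × B)) f).symm

/-- The probability of the last step of the path `extend z v`. -/
def lastProb {n : ℕ} (G : POMG (n + 1) S X Y A B) (μ : Strategy X A) (ν : Strategy Y B)
    (z : StatePath n S A B) (v : S n × A × B) : ℝ :=
  G.enter (extend z v) n (Nat.lt_succ_self n) * μ n (G.obsX n v.1) v.2.1 * ν n (G.obsY n v.1) v.2.2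

lemma pathProb_extend {n : ℕ} (G : POMG (n + 1) S X Y A B) (μ : Strategy X A) (ν : Strategy Y B)
    (z : StatePath n S A B) (v : S n × A × B) :
    G.pathProb μ ν (extend z v) = G.truncate.pathProb μ ν z * G.lastProb μ ν z v := by
  have key : ∀ (k : ℕ) (hk : k < n), G.enter (extend z v) k (Nat.lt_succ_of_lt hk) =
      G.truncate.enter z k hk := by
    intro k hk
    cases k with
    | zero => simp only [enter]; rw [extend_of_lt z v 0 hk]; rfl
    | succ k =>
      simp only [enter]; rw [extend_of_lt z v (k + 1) hk, extend_of_lt z v k (by omega)]; rfl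
  rw [pathProb, Fin.prod_univ_castSucc, pathProb, lastProb]
  congr 1
  · refine prod_congr rfl fun k _ => ?_
    rw [extend_castSucc]
    have := key k k.2
    simp only [Fin.val_castSucc] at this ⊢
    rw [this]; rfl
  · rw [extend_last]; rfl

lemma sum_lastProb {n : ℕ} (G : POMG (n + 1) S X Y A B) {μ : Strategy X A} {ν : Strategy Y B}
    (hμ : ∀ x, ∑ a, μ n x a = 1) (hν : ∀ y, ∑ b, ν n y b = 1) (z : StatePath n S A B) :
    ∑ v, G.lastProb μ ν z v = 1 := by
  cases n with
  | zero =>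
    have : ∀ v, G.lastProb μ ν z v =
        G.init v.1 * μ 0 (G.obsX 0 v.1) v.2.1 * ν 0 (G.obsY 0 v.1) v.2.2 := fun v => by
      simp only [lastProb, enter]
      rw [show extend z v ⟨0, Nat.lt_succ_self 0⟩ = v from extend_last z v]
    simp only [this, Fintype.sum_prod_type, ← mul_sum, hν, mul_one, hμ]
    exact G.init_mem.2
  | succ n =>
    have : ∀ v, G.lastProb μ ν z v =
        G.trans n (z (Fin.last n)).1 (z (Fin.last n)).2.1 (z (Fin.last n)).2.2 v.1 *
          μ (n + 1) (G.obsX (n + 1) v.1) v.2.1 * ν (n + 1) (G.obsY (n + 1) v.1) v.2.2 := fun v => by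
      simp only [lastProb, enter]
      rw [show extend z v ⟨n + 1, Nat.lt_succ_self _⟩ = v from extend_last z v,
        extend_of_lt z v n (Nat.lt_succ_self n)]
      rfl
    simp only [this, Fintype.sum_prod_type, ← mul_sum, hν, mul_one, hμ]
    exact (G.trans_mem n (by omega) _ _ _).2

/-- Only the layers after `k` matter for the step of an episode in layer `k`: in the earlier layers,
`μ` and `ν` may be any families of reals. -/
theorem sum_pathProb_mul (G : POMG H S X Y A B) {μ : Strategy X A} {ν : Strategy Y B} {k : ℕ}
    (hk : k < H) (hμ : ∀ j < H, k < j → ∀ x, ∑ a, μ j x a = 1)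
    (hν : ∀ j < H, k < j → ∀ y, ∑ b, ν j y b = 1) (g : S k × A × B → ℝ) :
    ∑ z, G.pathProb μ ν z * g (z ⟨k, hk⟩) =
      ∑ v : S k × A × B, G.seqTrans k v.1 * seqForm G.prevX μ k (G.obsX k v.1) v.2.1 *
        seqForm G.prevY ν k (G.obsY k v.1) v.2.2 * g v := by
  induction H generalizing k with
  | zero => omega
  | succ n ih =>
    rw [sum_extend]
    simp only [pathProb_extend]
    -- A last layer beyond `k` sums to one and is dropped. If `k` is the last layer, the step before
    -- it is handled by induction.
    rcases Nat.lt_succ_iff_lt_or_eq.mp hk with hkn | rfl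
    · have h1 : ∀ z : StatePath n S A B, ∑ v, G.truncate.pathProb μ ν z * G.lastProb μ ν z v *
          g (extend z v ⟨k, hk⟩) = G.truncate.pathProb μ ν z * g (z ⟨k, hkn⟩) := by
        intro z
        simp_rw [extend_of_lt z _ k hkn]
        rw [← sum_mul, ← mul_sum, sum_lastProb G (hμ n (by omega) hkn) (hν n (by omega) hkn),
          mul_one]
      simp only [h1]
      rw [ih G.truncate hkn (fun j hj => hμ j (by omega)) (fun j hj => hν j (by omega))]
      simp only [seqTrans_truncate]
      rfl
    · have h1 : ∀ z v, g (extend (A := A) (B := B) (S := S) z v ⟨k, hk⟩) = g v := fun z v => by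
        rw [show extend z v ⟨k, hk⟩ = v from extend_last z v]
      simp only [h1]
      rw [sum_comm]
      refine sum_congr rfl fun v _ => ?_
      rw [← sum_mul]
      congr 1
      cases k with
      | zero =>
        simp only [lastProb, enter, seqForm, seqTrans]
        rw [Fintype.sum_unique]
        rw [show extend _ v ⟨0, hk⟩ = v from extend_last _ v]
        simp [pathProb]
      | succ m =>
        have h2 : ∀ z : StatePath (m + 1) S A B, G.truncate.pathProb μ ν z * G.lastProb μ ν z v =
            (G.truncate.pathProb μ ν z * (fun u : S m × A × B => G.trans m u.1 u.2.1 u.2.2 v.1)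
              (z ⟨m, Nat.lt_succ_self m⟩)) *
            (μ (m + 1) (G.obsX (m + 1) v.1) v.2.1 * ν (m + 1) (G.obsY (m + 1) v.1) v.2.2) := by
          intro z
          simp only [lastProb, enter]
          rw [show extend z v ⟨m + 1, hk⟩ = v from extend_last z v,
            extend_of_lt z v m (Nat.lt_succ_self m)]
          ring
        simp only [h2]
        -- The induction hypothesis is applied with `g` the probability of moving into `v.1`. The
        -- tree structure then leaves only the term at `prevS`.
        have h3 := ih G.truncate (Nat.lt_succ_self m) (fun j hj hj' => by omega)
          (fun j hj hj' => by omega) fun u : S m × A × B => G.trans m u.1 u.2.1 u.2.2 v.1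
        beta_reduce at h3
        rw [← sum_mul, h3, sum_eq_single (G.prevS m v.1)]
        · simp only [seqTrans_truncate, seqTrans, seqForm, G.prevX_unique, G.prevY_unique]
          simp only [truncate]
          ring
        · intro u _ hu
          by_cases h0 : G.trans m u.1 u.2.1 u.2.2 v.1 = 0
          · simp [h0]
          · exact absurd (G.prevS_unique m _ _ _ _ h0).symm hu
        · simp

end POMG

/-! ### Policies -/

section Policies

variable {H : ℕ} {X : ℕ → Type*} {A : Type*} [Fintype A]

lemma IsPolicy.nonneg {μ : Strategy X A} (hμ : IsPolicy H μ) {h : ℕ} (hh : h < H) (x : X h) (a : A) :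
    0 ≤ μ h x a := (hμ h hh x).1 a

lemma IsPolicy.sum_eq_one {μ : Strategy X A} (hμ : IsPolicy H μ) {h : ℕ} (hh : h < H) (x : X h) :
    ∑ a, μ h x a = 1 := (hμ h hh x).2

lemma IsPolicy.hybrid {μ' μ : Strategy X A} (hμ' : IsPolicy H μ') (hμ : IsPolicy H μ) (h : ℕ) :
    IsPolicy H (hybrid h μ' μ) := by
  intro k hk x
  by_cases e : k < h
  · simpa [_root_.hybrid, e] using hμ' k hk x
  · simpa [_root_.hybrid, e] using hμ k hk x

lemma IsPolicy.seqForm_nonneg (prev : ∀ h, X (h + 1) → X h × A) {μ : Strategy X A}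
    (hμ : IsPolicy H μ) {h : ℕ} (hh : h < H) (x : X h) (a : A) : 0 ≤ seqForm prev μ h x a :=
  _root_.seqForm_nonneg prev (fun _ hj => hμ.nonneg (hj.trans_lt hh)) x a

lemma IsPolicy.seqPre_nonneg (prev : ∀ h, X (h + 1) → X h × A) {μ : Strategy X A}
    (hμ : IsPolicy H μ) {h : ℕ} (hh : h < H) (x : X h) : 0 ≤ seqPre prev μ h x :=
  _root_.seqPre_nonneg prev (fun _ hj => hμ.nonneg (hj.trans hh)) x

end Policies

/-! ### Counterfactual losses -/

namespace POMG

variable {H : ℕ} {S X Y : ℕ → Type*} {A B : Type*} [∀ h, Fintype (S h)] [∀ h, Fintype (X h)]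
  [Fintype A] [Fintype B]

lemma ae_reward_mem (G : POMG H S X Y A B) (h : ℕ) (s : S h) (a : A) (b : B) :
    ∀ᵐ r ∂(G.reward h s a b : Measure ℝ), r ∈ Set.Icc (0 : ℝ) 1 :=
  (prob_compl_eq_zero_iff measurableSet_Icc).2 (G.reward_mem h s a b)

lemma integrable_reward (G : POMG H S X Y A B) (h : ℕ) (s : S h) (a : A) (b : B) :
    Integrable (fun r : ℝ => r) (G.reward h s a b : Measure ℝ) :=
  Integrable.of_bound (by fun_prop) 1 <| by
    filter_upwards [G.ae_reward_mem h s a b] with r hr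
    rw [Real.norm_eq_abs, abs_of_nonneg hr.1]; exact hr.2

lemma meanReward_mem (G : POMG H S X Y A B) (h : ℕ) (s : S h) (a : A) (b : B) :
    G.meanReward h s a b ∈ Set.Icc (0 : ℝ) 1 := by
  refine ⟨integral_nonneg_of_ae ?_, ?_⟩
  · filter_upwards [G.ae_reward_mem h s a b] with r hr using hr.1
  · refine (integral_mono_ae (G.integrable_reward h s a b) (integrable_const 1) ?_).trans (by simp)
    filter_upwards [G.ae_reward_mem h s a b] with r hr using hr.2

lemma seqTrans_nonneg (G : POMG H S X Y A B) {h : ℕ} (hh : h < H) (s : S h) : 0 ≤ G.seqTrans h s := by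
  induction h with
  | zero => exact G.init_mem.1 s
  | succ h ih => exact mul_nonneg (ih (by omega) _) ((G.trans_mem h hh _ _ _).1 _)

lemma loss_nonneg (G : POMG H S X Y A B) {ν : Strategy Y B} (hν : IsPolicy H ν) {h : ℕ} (hh : h < H)
    (x : X h) (a : A) : 0 ≤ G.loss ν h x a :=
  sum_nonneg fun s _ => sum_nonneg fun b _ => mul_nonneg
    (mul_nonneg (G.seqTrans_nonneg hh s) (hν.seqForm_nonneg _ hh _ _))
    (sub_nonneg.2 (G.meanReward_mem h s a b).2)

/-- The expected loss in layer `k` is the pairing of the sequence form with the loss function. -/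
theorem sum_pathProb_loss (G : POMG H S X Y A B) {μ : Strategy X A} {ν : Strategy Y B} {k : ℕ}
    (hk : k < H) (hμ : ∀ j < H, k < j → ∀ x, ∑ a, μ j x a = 1) (hν : IsPolicy H ν) :
    ∑ z, G.pathProb μ ν z *
        (1 - G.meanReward k (z ⟨k, hk⟩).1 (z ⟨k, hk⟩).2.1 (z ⟨k, hk⟩).2.2) =
      ∑ x, ∑ a, seqForm G.prevX μ k x a * G.loss ν k x a := by
  classical
  have h1 := G.sum_pathProb_mul hk hμ (fun j hj _ => hν.sum_eq_one hj)
    fun v : S k × A × B => 1 - G.meanReward k v.1 v.2.1 v.2.2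
  beta_reduce at h1
  rw [h1, sum_comm]
  simp only [Fintype.sum_prod_type, loss, mul_sum]
  rw [sum_comm]
  refine sum_congr rfl fun a _ => ?_
  rw [← sum_fiberwise (g := G.obsX k) univ]
  refine sum_congr rfl fun x _ => ?_
  refine sum_congr (by ext; simp) fun s hs => sum_congr rfl fun b _ => ?_
  simp only [mem_filter] at hs
  rw [← hs.2]
  ring

lemma sum_pathProb (G : POMG H S X Y A B) {μ : Strategy X A} {ν : Strategy Y B}
    (hμ : IsPolicy H μ) (hν : IsPolicy H ν) : ∑ z, G.pathProb μ ν z = 1 := by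
  induction H with
  | zero => rw [Fintype.sum_unique]; simp [pathProb]
  | succ n ih =>
    rw [sum_extend]
    simp only [pathProb_extend, ← mul_sum]
    rw [sum_congr rfl fun z _ => by
      rw [G.sum_lastProb (hμ.sum_eq_one (Nat.lt_succ_self n)) (hν.sum_eq_one (Nat.lt_succ_self n))]]
    simp only [mul_one]
    exact ih G.truncate (fun h hh => hμ h (by omega)) (fun h hh => hν h (by omega))

lemma enter_nonneg (G : POMG H S X Y A B) (z : StatePath H S A B) (k : ℕ) (hk : k < H) :
    0 ≤ G.enter z k hk := by
  cases k with
  | zero => exact G.init_mem.1 _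
  | succ k => exact (G.trans_mem k hk _ _ _).1 _

lemma pathProb_nonneg (G : POMG H S X Y A B) {μ : Strategy X A} {ν : Strategy Y B}
    (hμ : IsPolicy H μ) (hν : IsPolicy H ν) (z : StatePath H S A B) : 0 ≤ G.pathProb μ ν z :=
  prod_nonneg fun k _ => mul_nonneg (mul_nonneg (G.enter_nonneg z k k.2) (hμ.nonneg k.2 _ _))
    (hν.nonneg k.2 _ _)

/-- The sum is the expected loss of one layer in an actual episode, and mean rewards are
nonnegative. -/
lemma sum_seqForm_mul_loss_le_one (G : POMG H S X Y A B) {μ : Strategy X A} {ν : Strategy Y B}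
    (hμ : IsPolicy H μ) (hν : IsPolicy H ν) {k : ℕ} (hk : k < H) :
    ∑ x, ∑ a, seqForm G.prevX μ k x a * G.loss ν k x a ≤ 1 := by
  rw [← G.sum_pathProb_loss hk (fun j hj _ => hμ.sum_eq_one hj) hν]
  refine (sum_le_sum fun z _ => ?_).trans_eq (G.sum_pathProb hμ hν)
  refine mul_le_of_le_one_right (G.pathProb_nonneg hμ hν z) ?_
  linarith [(G.meanReward_mem k (z ⟨k, hk⟩).1 (z ⟨k, hk⟩).2.1 (z ⟨k, hk⟩).2.2).1]

/-- The counterfactual loss at `(x_h, a_h)` if the max-player follows `μ` after layer `h`. -/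
def cfLoss (G : POMG H S X Y A B) (μ : Strategy X A) (ν : Strategy Y B) (h : ℕ) (x : X h) (a : A) :
    ℝ :=
  ∑ k ∈ Ico h H, ∑ x' : X k, ∑ a' : A, seqForm G.prevX (branch μ h x a) k x' a' * G.loss ν k x' a'

lemma cfLoss_nonneg (G : POMG H S X Y A B) {μ : Strategy X A} {ν : Strategy Y B}
    (hμ : IsPolicy H μ) (hν : IsPolicy H ν) (h : ℕ) (x : X h) (a : A) :
    0 ≤ G.cfLoss μ ν h x a :=
  sum_nonneg fun _ hk => sum_nonneg fun _ _ => sum_nonneg fun _ _ => mul_nonneg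
    (seqForm_branch_nonneg _ (fun _ hj => hμ.nonneg (hj.trans_lt (mem_Ico.1 hk).2)) _ _ _ _)
    (G.loss_nonneg hν (mem_Ico.1 hk).2 _ _)

/-- Both sides are the loss from layer `h` on when `ρ` is followed through layer `h` and `μ`
afterwards. -/
lemma sum_seqForm_mul_cfLoss (G : POMG H S X Y A B) (ρ μ : Strategy X A) (ν : Strategy Y B) (h : ℕ) :
    ∑ x, ∑ a, seqForm G.prevX ρ h x a * G.cfLoss μ ν h x a =
      ∑ k ∈ Ico h H, ∑ x, ∑ a, seqForm G.prevX (hybrid (h + 1) ρ μ) k x a * G.loss ν k x a := by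
  simp only [cfLoss, mul_sum, ← mul_assoc]
  calc _ = ∑ x : X h, ∑ k ∈ Ico h H, ∑ a, ∑ x', ∑ a', seqForm G.prevX ρ h x a *
          seqForm G.prevX (branch μ h x a) k x' a' * G.loss ν k x' a' :=
        sum_congr rfl fun x _ => sum_comm
    _ = ∑ k ∈ Ico h H, ∑ x : X h, ∑ a, ∑ x', ∑ a', seqForm G.prevX ρ h x a *
          seqForm G.prevX (branch μ h x a) k x' a' * G.loss ν k x' a' := sum_comm
    _ = _ := sum_congr rfl fun k hk => by
        simp only [← sum_seqForm_mul_branch G.prevX ρ μ h (mem_Ico.1 hk).1, sum_mul]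
        simp only [← Fintype.sum_prod_type']
        exact Fintype.sum_equiv ⟨fun p => (p.2.2.1, p.2.2.2, p.1, p.2.1),
          fun p => (p.2.2.1, p.2.2.2, p.1, p.2.1), fun _ => rfl, fun _ => rfl⟩ _ _ fun _ => rfl

lemma sum_seqForm_mul_cfLoss_le (G : POMG H S X Y A B) {ρ μ : Strategy X A} {ν : Strategy Y B}
    (hρ : IsPolicy H ρ) (hμ : IsPolicy H μ) (hν : IsPolicy H ν) (h : ℕ) :
    ∑ x, ∑ a, seqForm G.prevX ρ h x a * G.cfLoss μ ν h x a ≤ H := by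
  rw [sum_seqForm_mul_cfLoss]
  calc _ ≤ ∑ k ∈ Ico h H, (1 : ℝ) := sum_le_sum fun k hk =>
        G.sum_seqForm_mul_loss_le_one (hρ.hybrid hμ _) hν (mem_Ico.1 hk).2
    _ ≤ H := by simp

lemma pairing_loss_le (G : POMG H S X Y A B) {μ : Strategy X A} {ν : Strategy Y B}
    (hμ : IsPolicy H μ) (hν : IsPolicy H ν) : G.pairing μ (G.loss ν) ≤ H := by
  calc _ ≤ ∑ k ∈ range H, (1 : ℝ) := sum_le_sum fun k hk =>
        G.sum_seqForm_mul_loss_le_one hμ hν (mem_range.1 hk)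
    _ = H := by simp

lemma pairing_loss_nonneg (G : POMG H S X Y A B) {μ : Strategy X A} {ν : Strategy Y B}
    (hμ : IsPolicy H μ) (hν : IsPolicy H ν) : 0 ≤ G.pairing μ (G.loss ν) :=
  sum_nonneg fun _ hk => sum_nonneg fun _ _ => sum_nonneg fun _ _ => mul_nonneg
    (hμ.seqForm_nonneg _ (mem_range.1 hk) _ _) (G.loss_nonneg hν (mem_range.1 hk) _ _)

/-- The regret against `μ'` is the sum over all infosets of the counterfactual regrets. -/
theorem pairing_sub_pairing (G : POMG H S X Y A B) (μ μ' : Strategy X A) (ν : Strategy Y B) :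
    G.pairing μ (G.loss ν) - G.pairing μ' (G.loss ν) =
      ∑ h ∈ range H, ∑ x, seqPre G.prevX μ' h x *
        ∑ a, (μ h x a - μ' h x a) * G.cfLoss μ ν h x a := by
  have h0 : G.pairing μ (G.loss ν) = G.pairing (hybrid 0 μ' μ) (G.loss ν) := by
    congr 1
  have hH : G.pairing μ' (G.loss ν) = G.pairing (hybrid H μ' μ) (G.loss ν) := by
    refine sum_congr rfl fun k hk => ?_
    rw [seqForm_congr G.prevX (μ' := hybrid H μ' μ) fun j hj => ?_]
    simp [hybrid, hj.trans_lt (mem_range.1 hk)]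
  rw [h0, hH, ← sum_range_sub' fun h => G.pairing (hybrid h μ' μ) (G.loss ν)]
  refine sum_congr rfl fun h hh => ?_
  -- The dependence on the strategy in layers up to `h` splits into the earlier losses and the
  -- counterfactual losses at layer `h`. Two neighbouring hybrids differ only in layer `h`, so the
  -- earlier losses cancel.
  have key : ∀ ρ : Strategy X A, G.pairing (hybrid (h + 1) ρ μ) (G.loss ν) =
      (∑ k ∈ range h, ∑ x, ∑ a, seqForm G.prevX ρ k x a * G.loss ν k x a) +
        ∑ x, ∑ a, seqForm G.prevX ρ h x a * G.cfLoss μ ν h x a := by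
    intro ρ
    rw [pairing, sum_seqForm_mul_cfLoss, ← sum_range_add_sum_Ico _ (mem_range.1 hh).le]
    congr 1
    refine sum_congr rfl fun k hk => ?_
    rw [seqForm_congr G.prevX fun j hj => ?_]
    simp [hybrid, show j < h + 1 by have := mem_range.1 hk; omega]
  have h1 : hybrid h μ' μ = hybrid (h + 1) (hybrid h μ' μ) μ := by
    funext k; simp only [hybrid]; split_ifs <;> first | rfl | omega
  rw [h1, key, key, sum_congr rfl fun k hk => by
    rw [seqForm_congr G.prevX (μ' := μ') fun j hj => by
      simp [hybrid, show j < h by have := mem_range.1 hk; omega]], add_sub_add_left_eq_sub]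
  simp only [← sum_sub_distrib, mul_sum]
  refine sum_congr rfl fun x _ => sum_congr rfl fun a _ => ?_
  rw [seqForm_eq_seqPre_mul, seqForm_eq_seqPre_mul, seqPre_congr G.prevX (μ' := μ') fun j hj => by
    simp [hybrid, hj]]
  simp only [hybrid, lt_irrefl, if_false]
  ring

-- Moving the visit indicator into the strategy turns a weighted loss into an ordinary path sum, to
-- which `sum_pathProb_loss` applies.
open Classical in
lemma pathProb_through (G : POMG H S X Y A B) (μ : Strategy X A) (ν : Strategy Y B) {h : ℕ}
    (hh : h < H) (x : X h) (a : A) (z : StatePath H S A B) :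
    G.pathProb (through μ h x a) ν z = G.pathProb μ ν z *
      if G.obsX h (z ⟨h, hh⟩).1 = x ∧ (z ⟨h, hh⟩).2.1 = a then 1 else 0 := by
  rw [pathProb, pathProb, ← mul_prod_erase univ _ (mem_univ (⟨h, hh⟩ : Fin H)),
    ← mul_prod_erase univ (fun k : Fin H => G.enter z k k.2 * μ k (G.obsX k (z k).1) (z k).2.1 *
    ν k (G.obsY k (z k).1) (z k).2.2) (mem_univ (⟨h, hh⟩ : Fin H))]
  rw [prod_congr rfl fun k hk => by
    rw [through_apply_of_ne μ x a (k := k) fun e => (mem_erase.1 hk).1 (Fin.ext e)]]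
  simp only [through, Function.update_self]
  ring

lemma branch_mix (G : POMG H S X Y A B) (h : ℕ) (μ : Strategy X A) (x : X h) (a : A) :
    branch (G.mix h μ) h x a = branch μ h x a := by
  funext k
  by_cases hk : k = h
  · subst hk; simp [branch]
  · simp only [branch, Function.update_of_ne hk, hybrid]
    split_ifs with e
    · rfl
    · funext x a; simp [mix, show ¬ k ≤ h by omega]

open Classical in
/-- The losses after a visit to `(x, a)`, weighted by importance, are an unbiased estimate of the
counterfactual loss at `(x, a)`. -/
theorem sum_pathProb_mix (G : POMG H S X Y A B) {μ : Strategy X A} {ν : Strategy Y B}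
    (hμ : IsPolicy H μ) (hν : IsPolicy H ν) {h : ℕ} (hh : h < H) (x : X h) (a : A)
    (hne : seqForm G.prevX (G.balanced h) h x a ≠ 0) :
    ∑ z, G.pathProb (G.mix h μ) ν z *
        ((if G.obsX h (z ⟨h, hh⟩).1 = x ∧ (z ⟨h, hh⟩).2.1 = a then 1 else 0) /
          seqForm G.prevX (G.balanced h) h x a *
        ∑ k : Fin H with h ≤ k.1, (1 - G.meanReward k (z k).1 (z k).2.1 (z k).2.2)) =
      G.cfLoss μ ν h x a := by
  have hmix : seqForm G.prevX (G.mix h μ) h = seqForm G.prevX (G.balanced h) h :=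
    seqForm_congr _ fun j hj => by funext x a; simp [mix, hj]
  have h1 : ∀ k : Fin H, h ≤ k.1 → ∑ z, G.pathProb (through (G.mix h μ) h x a) ν z *
      (1 - G.meanReward k (z k).1 (z k).2.1 (z k).2.2) =
      seqForm G.prevX (G.balanced h) h x a * ∑ x', ∑ a',
        seqForm G.prevX (branch μ h x a) k x' a' * G.loss ν k x' a' := by
    intro k hk
    -- In layer `h` the strategy `through` need not sum to one. This is harmless because
    -- normalization is required only after layer `k ≥ h`.
    refine (G.sum_pathProb_loss k.2 (fun j hj hkj x' => ?_) hν).trans ?_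
    · rw [through_apply_of_ne _ _ _ (by omega)]
      simpa [mix, show ¬ j ≤ h by omega] using hμ.sum_eq_one hj x'
    · simp only [seqForm_through _ _ _ _ _ hk, branch_mix, hmix, mul_sum, mul_assoc]
  have h2 : ∀ z, G.pathProb (G.mix h μ) ν z *
        ((if G.obsX h (z ⟨h, hh⟩).1 = x ∧ (z ⟨h, hh⟩).2.1 = a then 1 else 0) /
          seqForm G.prevX (G.balanced h) h x a *
        ∑ k : Fin H with h ≤ k.1, (1 - G.meanReward k (z k).1 (z k).2.1 (z k).2.2)) =
      (seqForm G.prevX (G.balanced h) h x a)⁻¹ * ∑ k : Fin H with h ≤ k.1,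
        G.pathProb (through (G.mix h μ) h x a) ν z *
          (1 - G.meanReward k (z k).1 (z k).2.1 (z k).2.2) := by
    intro z
    rw [G.pathProb_through _ _ hh, ← mul_sum]
    ring
  rw [sum_congr rfl fun z _ => h2 z, ← mul_sum, sum_comm,
    sum_congr rfl fun k hk => h1 k (mem_filter.1 hk).2, ← mul_sum, ← mul_assoc,
    inv_mul_cancel₀ hne, one_mul, cfLoss]
  symm
  refine sum_bij' (fun k hk => (⟨k, (mem_Ico.1 hk).2⟩ : Fin H)) (fun k _ => k.1) ?_ ?_ ?_ ?_ ?_ <;>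
    simp +contextual

end POMG

/-! ### Balanced exploration -/

namespace POMG

variable {H : ℕ} {S X Y : ℕ → Type*} {A B : Type*} [∀ h, Fintype (S h)] [∀ h, Fintype (X h)]
  [Fintype A] [Fintype B]

/-- A transition distribution charges some state, whose infoset is a child. Hence no `C_k(x, a)` is
empty, which keeps the balanced policy positive and the importance weights finite. -/
lemma exists_prevX_eq [Nonempty B] (G : POMG H S X Y A B) {h : ℕ} (hh : h + 1 < H) (x : X h) (a : A) :
    ∃ x', G.prevX h x' = (x, a) := by
  obtain ⟨s, rfl⟩ := G.obsX_surjective h x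
  obtain ⟨b⟩ := ‹Nonempty B›
  obtain ⟨s', -, hs'⟩ := exists_ne_zero_of_sum_ne_zero
    ((G.trans_mem h hh s a b).2.trans_ne one_ne_zero)
  exact ⟨G.obsX (h + 1) s', by rw [G.prevX_unique, G.prevS_unique h s a b s' hs']⟩

lemma Reach.lt {G : POMG H S X Y A B} {h k : ℕ} {x : X h} {a : A} {x' : X k}
    (r : G.Reach x a k x') : h < k := by
  induction r with
  | child => exact Nat.lt_succ_self h
  | step _ _ _ ih => exact Nat.lt_succ_of_lt ih

lemma reach_succ_self {G : POMG H S X Y A B} {h : ℕ} {x : X h} {a : A} {x' : X (h + 1)} :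
    G.Reach x a (h + 1) x' ↔ G.prevX h x' = (x, a) := by
  refine ⟨fun r => ?_, .child x'⟩
  cases r with
  | child _ e => exact e
  | step _ _ r => exact absurd r.lt (lt_irrefl _)

lemma reach_succ {G : POMG H S X Y A B} {h k : ℕ} (hk : h < k) {x : X h} {a : A} {x' : X (k + 1)} :
    G.Reach x a (k + 1) x' ↔ G.Reach x a k (G.prevX k x').1 := by
  refine ⟨fun r => ?_, .step k x'⟩
  cases r with
  | child _ e => exact absurd hk (lt_irrefl _)
  | step _ _ r => exact r

lemma exists_reach [Nonempty B] (G : POMG H S X Y A B) {h k : ℕ} (hk : h < k) (hkH : k < H) (x : X h)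
    (a : A) : ∃ x', G.Reach x a k x' := by
  induction k, hk using Nat.le_induction with
  | base => exact (G.exists_prevX_eq hkH x a).imp fun x' => .child x'
  | succ k hk ih =>
    obtain ⟨x', r⟩ := ih (by omega)
    obtain ⟨x'', e⟩ := G.exists_prevX_eq hkH x' a
    exact ⟨x'', .step k x'' (by rwa [e])⟩

/-- Perfect recall: histories are obtained by iterating `prevX`, so descendant sets of distinct
pairs are disjoint. -/
lemma Reach.unique {G : POMG H S X Y A B} {h k : ℕ} {x y : X h} {a b : A} {x' : X k}
    (r : G.Reach x a k x') (r' : G.Reach y b k x') : (x, a) = (y, b) := by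
  induction r with
  | child x' e => rw [← e, ← reach_succ_self.1 r']
  | step k x' r ih => exact ih ((reach_succ r.lt).1 r')

lemma reach_iff_exists_child {G : POMG H S X Y A B} {h k : ℕ} (hk : h + 1 < k) {x : X h} {a : A}
    {x' : X k} : G.Reach x a k x' ↔ ∃ c, G.prevX h c = (x, a) ∧ ∃ b, G.Reach c b k x' := by
  induction k, hk using Nat.le_induction with
  | base =>
    change G.Reach x a (h + 1 + 1) x' ↔ ∃ c, _ ∧ ∃ b, G.Reach c b (h + 1 + 1) x'
    rw [reach_succ (Nat.lt_succ_self h), reach_succ_self]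
    simp only [reach_succ_self]
    refine ⟨fun e => ⟨_, e, _, rfl⟩, ?_⟩
    rintro ⟨c, e, b, e'⟩
    rw [e', e]
  | succ k hk ih =>
    rw [reach_succ (by omega), ih]
    simp only [reach_succ (show h + 1 < k by omega)]

lemma mem_descAct {G : POMG H S X Y A B} {h k : ℕ} {x : X h} {a : A} {x' : X k} :
    x' ∈ G.descAct k x a ↔ G.Reach x a k x' := by
  simp [descAct]

lemma mem_desc {G : POMG H S X Y A B} {h k : ℕ} {x : X h} {x' : X k} :
    x' ∈ G.desc k x ↔ ∃ a, G.Reach x a k x' := by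
  classical simp [desc, mem_descAct]

lemma disjoint_desc {G : POMG H S X Y A B} {h k : ℕ} {x y : X h} (hxy : x ≠ y) :
    Disjoint (G.desc k x) (G.desc k y) := by
  rw [Finset.disjoint_left]
  intro x' hx hy
  obtain ⟨a, r⟩ := mem_desc.1 hx
  obtain ⟨b, r'⟩ := mem_desc.1 hy
  exact hxy (congrArg Prod.fst (r.unique r'))

lemma card_descAct_pos [Nonempty B] (G : POMG H S X Y A B) {h k : ℕ} (hk : h < k) (hkH : k < H)
    (x : X h) (a : A) : 0 < (G.descAct k x a).card := by
  obtain ⟨x', r⟩ := G.exists_reach hk hkH x a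
  exact card_pos.2 ⟨x', mem_descAct.2 r⟩

lemma card_desc_pos [Nonempty A] [Nonempty B] (G : POMG H S X Y A B) {h k : ℕ} (hk : h < k)
    (hkH : k < H) (x : X h) : 0 < (G.desc k x).card := by
  obtain ⟨a⟩ := ‹Nonempty A›
  obtain ⟨x', r⟩ := G.exists_reach hk hkH x a
  exact card_pos.2 ⟨x', mem_desc.2 ⟨a, r⟩⟩

lemma balanced_pos [Nonempty A] [Nonempty B] (G : POMG H S X Y A B) {h : ℕ} (hh : h < H) (k : ℕ)
    (x : X k) (a : A) : 0 < G.balanced h k x a := by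
  rw [balanced]
  split_ifs with hk
  · exact div_pos (Nat.cast_pos.2 (G.card_descAct_pos hk hh x a))
      (Nat.cast_pos.2 (G.card_desc_pos hk hh x))
  · exact one_div_pos.2 (Nat.cast_pos.2 Fintype.card_pos)

lemma seqForm_balanced (G : POMG H S X Y A B) (h : ℕ) (x : X h) (a : A) :
    seqForm G.prevX (G.balanced h) h x a =
      seqPre G.prevX (G.balanced h) h x / Fintype.card A := by
  rw [seqForm_eq_seqPre_mul]
  simp [balanced, div_eq_mul_inv]

lemma seqPre_balanced_pos [Nonempty A] [Nonempty B] (G : POMG H S X Y A B) {h : ℕ} (hh : h < H)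
    (x : X h) : 0 < seqPre G.prevX (G.balanced h) h x :=
  seqPre_pos _ (fun j _ => G.balanced_pos hh j) x

lemma seqForm_balanced_pos [Nonempty A] [Nonempty B] (G : POMG H S X Y A B) {h : ℕ} (hh : h < H)
    (x : X h) (a : A) : 0 < seqForm G.prevX (G.balanced h) h x a :=
  seqForm_pos _ (fun j _ => G.balanced_pos hh j) x a

/-- The number of infosets in layer `h` below an infoset of an earlier layer. -/
def leaves (G : POMG H S X Y A B) (h k : ℕ) (x : X k) : ℝ :=
  if k < h then ((G.desc h x).card : ℝ) else 1

-- Below layer `k + 1`, each descendant of `(x, a)` passes through exactly one child. In layer `k +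
-- 1` itself, the children are the descendants.
open Classical in
lemma sum_leaves_children (G : POMG H S X Y A B) {h k : ℕ} (hk : k < h) (x : X k) (a : A) :
    ∑ c with G.prevX k c = (x, a), G.leaves h (k + 1) c = (G.descAct h x a).card := by
  rcases (Nat.succ_le_of_lt hk).eq_or_lt with rfl | hk'
  · simp only [leaves, lt_irrefl, if_false, sum_const, nsmul_eq_mul, mul_one]
    congr 2
    ext c
    simp [mem_descAct, reach_succ_self]
  · simp only [leaves, if_pos hk']
    rw [← Nat.cast_sum, ← card_biUnion fun c _ c' _ hc => disjoint_desc hc]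
    congr 2
    ext x'
    simp [mem_descAct, mem_desc, reach_iff_exists_child hk']

lemma sum_leaves_le (G : POMG H S X Y A B) (h : ℕ) : ∑ x, G.leaves h 0 x ≤ Fintype.card (X h) := by
  classical
  rcases h.eq_zero_or_pos with rfl | hh
  · simp [leaves]
  · simp only [leaves, if_pos hh]
    rw [← Nat.cast_sum, ← card_biUnion fun c _ c' _ hc => disjoint_desc hc]
    exact Nat.cast_le.2 (card_le_univ _)

/-- The balancing property of `μ^{⋆,h}`. -/
theorem sum_seqPre_div_balanced_le [Nonempty A] [Nonempty B] (G : POMG H S X Y A B) {μ : Strategy X A}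
    (hμ : IsPolicy H μ) {h : ℕ} (hh : h < H) :
    ∑ x, seqPre G.prevX μ h x / seqPre G.prevX (G.balanced h) h x ≤ Fintype.card (X h) := by
  classical
  -- The leaf-weighted sum of ratios does not depend on the layer. The balanced policy gives `a` the
  -- share of leaves below it, which cancels against the leaves of the children and leaves the
  -- factor `μ(a | x)`, and these factors sum to one. At `k = h` all leaf weights are `1`.
  have key : ∀ k ≤ h, ∑ x, seqPre G.prevX μ k x / seqPre G.prevX (G.balanced h) k x *
      G.leaves h k x = ∑ x, G.leaves h 0 x := by
    intro k
    induction k with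
    | zero => intro _; simp [seqPre]
    | succ k ih =>
      intro hk
      rw [← ih (by omega), ← sum_fiberwise (g := G.prevX k) univ, Fintype.sum_prod_type]
      refine sum_congr rfl fun x _ => ?_
      have h1 : ∀ a, ∑ c with G.prevX k c = (x, a), seqPre G.prevX μ (k + 1) c /
          seqPre G.prevX (G.balanced h) (k + 1) c * G.leaves h (k + 1) c =
          μ k x a * (seqPre G.prevX μ k x / seqPre G.prevX (G.balanced h) k x *
            G.leaves h k x) := by
        intro a
        rw [sum_congr rfl fun c hc => by
          rw [seqPre, seqPre, (mem_filter.1 hc).2], ← mul_sum, G.sum_leaves_children hk,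
          seqForm_eq_seqPre_mul, seqForm_eq_seqPre_mul]
        have e1 := (G.card_descAct_pos hk hh x a).ne'
        have e2 := (G.card_desc_pos hk hh x).ne'
        have e3 : seqPre G.prevX (G.balanced h) k x ≠ 0 :=
          (seqPre_pos _ (fun j _ => G.balanced_pos hh j) x).ne'
        simp only [balanced, leaves, if_pos (show k < h from hk)]
        field_simp
      rw [sum_congr rfl fun a _ => h1 a, ← sum_mul, hμ.sum_eq_one (by omega), one_mul]
  refine le_trans (le_of_eq ?_) (G.sum_leaves_le h)
  rw [← key h le_rfl]
  simp [leaves]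

end POMG

/-! ### Regret matching -/

section RegretMatching

variable {A : Type*} [Fintype A]

lemma regretMatching_nonneg (R : A → ℝ) (a : A) : 0 ≤ regretMatching R a := by
  rw [regretMatching]
  split_ifs
  · positivity
  · exact div_nonneg (le_max_right _ _) (sum_nonneg fun _ _ => le_max_right _ _)

lemma sum_max_pos {R : A → ℝ} (hR : ¬ ∀ a, R a ≤ 0) : 0 < ∑ a, max (R a) 0 := by
  push Not at hR
  obtain ⟨a, ha⟩ := hR
  exact sum_pos' (fun _ _ => le_max_right _ _) ⟨a, mem_univ _, lt_max_of_lt_left ha⟩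

lemma regretMatching_mem_stdSimplex [Nonempty A] (R : A → ℝ) : regretMatching R ∈ stdSimplex ℝ A := by
  refine ⟨regretMatching_nonneg R, ?_⟩
  by_cases hR : ∀ a, R a ≤ 0
  · simp [regretMatching, hR]
  · simp only [regretMatching, hR, if_false]
    rw [← sum_div, div_self (sum_max_pos hR).ne']

/-- The forcing condition of Blackwell's approachability argument. -/
lemma sum_max_mul_regret_eq_zero [Nonempty A] (R l : A → ℝ) :
    ∑ a, max (R a) 0 * ((∑ a', regretMatching R a' * l a') - l a) = 0 := by
  by_cases hR : ∀ a, R a ≤ 0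
  · exact sum_eq_zero fun a _ => by rw [max_eq_right (hR a), zero_mul]
  · have h0 := (sum_max_pos hR).ne'
    simp only [mul_sub, sum_sub_distrib, ← sum_mul, regretMatching, hR, if_false, div_mul_eq_mul_div,
      ← sum_div]
    rw [mul_div_cancel₀ _ h0, sub_self]

/-- Regret matching against the losses `l 0, l 1, …`: the cumulative regrets `R t` grow at most like
the square root of the sum of the squared instantaneous regrets. -/
theorem sum_sq_regret_le [Nonempty A] (R l : ℕ → A → ℝ) (h0 : ∀ a, R 0 a = 0)
    (hs : ∀ t a, R (t + 1) a = R t a + ((∑ a', regretMatching (R t) a' * l t a') - l t a)) (T : ℕ) :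
    ∑ a, max (R T a) 0 ^ 2 ≤
      ∑ t ∈ range T, ∑ a, ((∑ a', regretMatching (R t) a' * l t a') - l t a) ^ 2 := by
  induction T with
  | zero => simp [h0]
  | succ T ih =>
    rw [sum_range_succ]
    -- Summed over actions, the cross term vanishes by the forcing condition, so the potential grows
    -- only by the squared increments.
    have h1 : ∀ u v : ℝ, max (u + v) 0 ^ 2 ≤ max u 0 ^ 2 + v ^ 2 + 2 * (max u 0 * v) := by
      intro u v
      have : max (u + v) 0 ^ 2 ≤ (max u 0 + v) ^ 2 := by
        rw [sq_le_sq]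
        rcases le_total 0 (u + v) with h | h
        · rw [max_eq_left h, abs_of_nonneg h]
          exact le_abs.2 (Or.inl (add_le_add_left (le_max_left _ _) _))
        · rw [max_eq_right h]; simp
      nlinarith
    calc _ ≤ ∑ a, (max (R T a) 0 ^ 2 + ((∑ a', regretMatching (R T) a' * l T a') - l T a) ^ 2 +
          2 * (max (R T a) 0 * ((∑ a', regretMatching (R T) a' * l T a') - l T a))) :=
          sum_le_sum fun a _ => by rw [hs]; exact h1 _ _
      _ = ∑ a, max (R T a) 0 ^ 2 +
          ∑ a, ((∑ a', regretMatching (R T) a' * l T a') - l T a) ^ 2 := by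
          rw [sum_add_distrib, sum_add_distrib, ← mul_sum, sum_max_mul_regret_eq_zero]; ring
      _ ≤ _ := by gcongr

/-- The instantaneous regrets are controlled by the first moments of nonnegative bounded losses. -/
lemma sum_sq_sub_le {p l : A → ℝ} {K : ℝ} (hp : p ∈ stdSimplex ℝ A) (hl : ∀ a, 0 ≤ l a)
    (hK : ∀ a, l a ≤ K) :
    ∑ a, ((∑ a', p a' * l a') - l a) ^ 2 ≤
      K * (Fintype.card A * ∑ a, p a * l a + ∑ a, l a) := by
  set m := ∑ a, p a * l a with hm
  have h0 : 0 ≤ m := sum_nonneg fun a _ => mul_nonneg (hp.1 a) (hl a)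
  have h1 : m ≤ K := by
    calc m ≤ ∑ a, p a * K := sum_le_sum fun a _ => mul_le_mul_of_nonneg_left (hK a) (hp.1 a)
      _ = K := by rw [← sum_mul, hp.2, one_mul]
  -- For `m, l ∈ [0, K]`, `(m - l)² ≤ m² + l² ≤ K m + K l`.
  calc _ ≤ ∑ a, (K * m + K * l a) := sum_le_sum fun a _ => by
        nlinarith [mul_nonneg h0 (hl a), mul_le_mul_of_nonneg_right h1 h0,
          mul_le_mul_of_nonneg_right (hK a) (hl a)]
    _ = _ := by rw [sum_add_distrib, ← mul_sum univ l]; simp; ring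

end RegretMatching

/-! ### The regret bound on the event on which the loss estimates concentrate -/

/-- The regret of regret matching with respect to the losses `L`, if it runs on estimates `l` that
concentrate around `L`. -/
lemma regretMatching_regret_le {A : Type*} [Fintype A] [Nonempty A] {R l L : ℕ → A → ℝ} {q : A → ℝ}
    {K η ι : ℝ} {T : ℕ} (hq : q ∈ stdSimplex ℝ A) (h0 : ∀ a, R 0 a = 0)
    (hs : ∀ t a, R (t + 1) a = R t a + ((∑ a', regretMatching (R t) a' * l t a') - l t a))
    (hL : ∀ t < T, ∀ a, 0 ≤ L t a)
    (hK : 0 < K) (hη : 0 < η) (hη1 : η ≤ 1) (hl : ∀ t < T, ∀ a, l t a ∈ Set.Icc 0 K)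
    (hup : ∀ a, ∑ t ∈ range T, l t a ≤ (1 + η) * ∑ t ∈ range T, L t a + K * ι / η)
    (hup' : ∑ t ∈ range T, ∑ a, regretMatching (R t) a * l t a ≤
      (1 + η) * ∑ t ∈ range T, ∑ a, regretMatching (R t) a * L t a + K * ι / η)
    (hlow : (1 - η) * ∑ t ∈ range T, ∑ a, regretMatching (R t) a * L t a - K * ι / η ≤
      ∑ t ∈ range T, ∑ a, regretMatching (R t) a * l t a) :
    ∑ t ∈ range T, ∑ a, (regretMatching (R t) a - q a) * L t a ≤
      (2 * η * (∑ t ∈ range T, ∑ a, regretMatching (R t) a * L t a) +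
        η * (∑ t ∈ range T, ∑ a, q a * L t a) +
        η * ∑ t ∈ range T, ∑ a, 1 / (Fintype.card A : ℝ) * L t a) +
      K * (2 * ι / η + ι + Fintype.card A / (2 * η)) := by
  have hA : (0 : ℝ) < Fintype.card A := Nat.cast_pos.2 Fintype.card_pos
  set m := (Fintype.card A : ℝ) with hm
  set P := ∑ t ∈ range T, ∑ a, regretMatching (R t) a * L t a with hP
  set P' := ∑ t ∈ range T, ∑ a, regretMatching (R t) a * l t a with hP'
  set Q := ∑ t ∈ range T, ∑ a, q a * L t a with hQ
  set U := ∑ t ∈ range T, ∑ a, L t a with hU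
  have hPos : 0 ≤ P := sum_nonneg fun t ht => sum_nonneg fun a _ =>
    mul_nonneg (regretMatching_nonneg _ _) (hL t (mem_range.1 ht) a)
  have hUos : 0 ≤ U := sum_nonneg fun t ht => sum_nonneg fun a _ => hL t (mem_range.1 ht) a
  have e1 : ∑ t ∈ range T, ∑ a, (regretMatching (R t) a - q a) * L t a = P - Q := by
    simp only [sub_mul, sum_sub_distrib, hP, hQ]
  have e2 : ∑ t ∈ range T, ∑ a, 1 / m * L t a = 1 / m * U := by
    simp only [hU, mul_sum]
  have e3 : Q = ∑ a, q a * ∑ t ∈ range T, L t a := by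
    rw [hQ, sum_comm]; simp only [mul_sum]
  have hRT : ∀ a, R T a = P' - ∑ t ∈ range T, l t a := by
    intro a
    have : ∀ n, R n a = ∑ t ∈ range n, ((∑ a', regretMatching (R t) a' * l t a') - l t a) := by
      intro n
      induction n with
      | zero => simp [h0]
      | succ n ih => rw [sum_range_succ, ← ih, hs]
    rw [this, sum_sub_distrib]
  -- the squared instantaneous regrets
  set Z := ∑ t ∈ range T, ∑ a, ((∑ a', regretMatching (R t) a' * l t a') - l t a) ^ 2 with hZ
  have hU' : ∑ t ∈ range T, ∑ a, l t a ≤ (1 + η) * U + m * (K * ι / η) := by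
    rw [sum_comm]
    calc _ ≤ ∑ a, ((1 + η) * ∑ t ∈ range T, L t a + K * ι / η) := sum_le_sum fun a _ => hup a
      _ = _ := by rw [sum_add_distrib, ← mul_sum, sum_comm]; simp [hm, hU]
  have hZle : Z ≤ K * (m * P' + ∑ t ∈ range T, ∑ a, l t a) := by
    rw [mul_add, ← mul_assoc, hP', mul_sum, mul_sum, ← sum_add_distrib]
    refine sum_le_sum fun t ht => ?_
    have := sum_sq_sub_le (regretMatching_mem_stdSimplex (R t))
      (fun a => (hl t (mem_range.1 ht) a).1) (fun a => (hl t (mem_range.1 ht) a).2)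
    linarith
  have hZ2 : Z ≤ 2 * K * (m * P + U + m * (K * ι / η)) := by
    refine hZle.trans ?_
    have h1 : (1 + η) * U ≤ 2 * U := by nlinarith
    have h2 : (1 + η) * P ≤ 2 * P := by nlinarith
    have h3 : m * P' ≤ m * (2 * P + K * ι / η) := by
      refine mul_le_mul_of_nonneg_left ?_ hA.le
      linarith
    calc _ ≤ K * (m * (2 * P + K * ι / η) + (2 * U + m * (K * ι / η))) := by
          refine mul_le_mul_of_nonneg_left ?_ hK.le
          linarith
      _ = _ := by ring
  -- The square root of the random quantity `Z` is linearized by `y ≤ c y² / 2 + 1 / (2c)`. With `c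
  -- = η / (m K)`, the bound on `Z` enters with coefficient exactly `η`.
  have hmax : ∀ a, R T a ≤ η / (2 * m * K) * Z + m * K / (2 * η) := by
    intro a
    have h1 : max (R T a) 0 ^ 2 ≤ Z :=
      (single_le_sum (f := fun a => max (R T a) 0 ^ 2) (fun _ _ => sq_nonneg _)
        (mem_univ a)).trans (sum_sq_regret_le R l h0 hs T)
    set y := max (R T a) 0
    have h2 : R T a ≤ y := le_max_left _ _
    set c := η / (m * K) with hc
    have hcpos : 0 < c := by positivity
    have h3 : y ≤ c / 2 * y ^ 2 + 1 / (2 * c) := by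
      have : c / 2 * y ^ 2 + 1 / (2 * c) - y = (c * y - 1) ^ 2 / (2 * c) := by
        field_simp; ring
      have : 0 ≤ (c * y - 1) ^ 2 / (2 * c) := by positivity
      linarith
    have h4 : c / 2 * y ^ 2 ≤ c / 2 * Z := mul_le_mul_of_nonneg_left h1 (by positivity)
    have h5 : c / 2 = η / (2 * m * K) := by rw [hc]; field_simp
    have h6 : 1 / (2 * c) = m * K / (2 * η) := by rw [hc]; field_simp
    rw [h5] at h3 h4
    rw [h6] at h3
    linarith
  have hmax2 : ∀ a, R T a ≤ η * P + η * (1 / m * U) + K * ι + K * (m / (2 * η)) := by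
    intro a
    refine (hmax a).trans ?_
    have h1 : η / (2 * m * K) * Z ≤
        η / (2 * m * K) * (2 * K * (m * P + U + m * (K * ι / η))) :=
      mul_le_mul_of_nonneg_left hZ2 (by positivity)
    have h2 : η / (2 * m * K) * (2 * K * (m * P + U + m * (K * ι / η))) =
        η * P + η * (1 / m * U) + K * ι := by
      field_simp
    have h3 : m * K / (2 * η) = K * (m / (2 * η)) := by ring
    linarith
  have hq1 : P' - ∑ a, q a * ∑ t ∈ range T, l t a ≤
      η * P + η * (1 / m * U) + K * ι + K * (m / (2 * η)) := by
    calc _ = ∑ a, q a * R T a := by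
          simp only [hRT, mul_sub, sum_sub_distrib, ← sum_mul, hq.2, one_mul]
      _ ≤ ∑ a, q a * (η * P + η * (1 / m * U) + K * ι + K * (m / (2 * η))) :=
          sum_le_sum fun a _ => mul_le_mul_of_nonneg_left (hmax2 a) (hq.1 a)
      _ = _ := by rw [← sum_mul, hq.2, one_mul]
  -- The comparator `q` is a fixed mixture of actions, so averaging the tail bounds for single
  -- actions suffices.
  have hq2 : ∑ a, q a * ∑ t ∈ range T, l t a ≤ (1 + η) * Q + K * ι / η := by
    calc _ ≤ ∑ a, q a * ((1 + η) * ∑ t ∈ range T, L t a + K * ι / η) :=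
          sum_le_sum fun a _ => mul_le_mul_of_nonneg_left (hup a) (hq.1 a)
      _ = _ := by
          simp only [mul_add, sum_add_distrib, ← sum_mul, hq.2, one_mul, e3, mul_sum]
          simp only [add_mul, mul_add, sum_add_distrib, one_mul, mul_left_comm]
  -- The lower tail replaces `P` by `P'`, the regret bound compares `P'` with the estimated loss of
  -- `q`, and the upper tail returns to `Q`. One `η P` comes from the lower tail, the other from
  -- `hmax2`.
  rw [e1, e2]
  have h9 : K * (2 * ι / η + ι + m / (2 * η)) =
    2 * (K * ι / η) + K * ι + K * (m / (2 * η)) := by ring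
  rw [h9]
  linarith

/-! ### Summing the local regrets over all infosets -/

namespace POMG

variable {H : ℕ} {S X Y : ℕ → Type*} {A B : Type*} [∀ h, Fintype (S h)] [∀ h, Fintype (X h)]
  [Fintype A] [Fintype B]

/-- The largest value of the loss estimators in the infoset `x`. -/
def estBound (G : POMG H S X Y A B) (h : ℕ) (x : X h) : ℝ :=
  H * Fintype.card A / seqPre G.prevX (G.balanced h) h x

lemma estBound_pos [Nonempty A] [Nonempty B] (G : POMG H S X Y A B) {h : ℕ} (hh : h < H) (x : X h) :
    0 < G.estBound h x :=
  div_pos (mul_pos (Nat.cast_pos.2 (by omega)) (Nat.cast_pos.2 Fintype.card_pos))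
    (G.seqPre_balanced_pos hh x)

/-- Here balancing pays off: the total weighted range is the same whatever policy the comparator is.
-/
lemma sum_seqPre_mul_estBound_le [Nonempty A] [Nonempty B] (G : POMG H S X Y A B) {μ : Strategy X A}
    (hμ : IsPolicy H μ) {h : ℕ} (hh : h < H) :
    ∑ x, seqPre G.prevX μ h x * G.estBound h x ≤ H * Fintype.card A * Fintype.card (X h) := by
  refine le_trans (le_of_eq ?_) (mul_le_mul_of_nonneg_left (G.sum_seqPre_div_balanced_le hμ hh)
    (by positivity : (0 : ℝ) ≤ H * Fintype.card A))
  rw [mul_sum]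
  exact sum_congr rfl fun x _ => by rw [estBound]; ring

/-- The left side is the loss, from layer `h` on, of the policy that plays `μ'` before `h`, `ρ` in
layer `h` and `μ` afterwards. -/
lemma sum_seqPre_mul_cfLoss_le (G : POMG H S X Y A B) {μ' ρ μ : Strategy X A} {ν : Strategy Y B}
    (hμ' : IsPolicy H μ') (hρ : IsPolicy H ρ) (hμ : IsPolicy H μ) (hν : IsPolicy H ν) (h : ℕ) :
    ∑ x, seqPre G.prevX μ' h x * ∑ a, ρ h x a * G.cfLoss μ ν h x a ≤ H := by
  refine le_trans (le_of_eq ?_) (G.sum_seqForm_mul_cfLoss_le (hμ'.hybrid hρ h) hμ hν h)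
  refine sum_congr rfl fun x _ => ?_
  rw [mul_sum]
  refine sum_congr rfl fun a _ => ?_
  rw [seqForm_eq_seqPre_mul, seqPre_congr G.prevX (μ := hybrid h μ' ρ) (μ' := μ') fun j hj => by
    simp [hybrid, hj]]
  simp [hybrid, mul_assoc]

lemma isPolicy_cfrPolicy [Nonempty A] (G : POMG H S X Y A B) (o : ℕ → ℕ → Obs H X A) (t : ℕ) :
    IsPolicy H (G.cfrPolicy o t) :=
  fun _ _ _ => regretMatching_mem_stdSimplex _

lemma isPolicy_uniform [Nonempty A] :
    IsPolicy H (fun _ _ _ => 1 / (Fintype.card A : ℝ) : Strategy X A) :=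
  fun _ _ _ => ⟨fun _ => by positivity, by simp⟩

/-- The regret of Balanced CFR if all the estimators concentrate around the counterfactual losses. -/
theorem regret_le_of_concentration [Nonempty A] [Nonempty B] (G : POMG H S X Y A B)
    {o : ℕ → ℕ → Obs H X A} {ν : ℕ → Strategy Y B} {T : ℕ} {η ι : ℝ}
    (hν : ∀ t < T, IsPolicy H (ν t)) (hη : 0 < η) (hη1 : η ≤ 1) (hι : 0 ≤ ι)
    (hl : ∀ h < H, ∀ x, ∀ t < T, ∀ a, G.lossEst (o t h) h x a ∈ Set.Icc 0 (G.estBound h x))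
    (hup : ∀ h < H, ∀ x a, ∑ t ∈ range T, G.lossEst (o t h) h x a ≤
      (1 + η) * ∑ t ∈ range T, G.cfLoss (G.cfrPolicy o t) (ν t) h x a + G.estBound h x * ι / η)
    (hup' : ∀ h < H, ∀ x, ∑ t ∈ range T, ∑ a, G.cfrPolicy o t h x a * G.lossEst (o t h) h x a ≤
      (1 + η) * ∑ t ∈ range T, ∑ a, G.cfrPolicy o t h x a *
        G.cfLoss (G.cfrPolicy o t) (ν t) h x a + G.estBound h x * ι / η)
    (hlow : ∀ h < H, ∀ x, (1 - η) * ∑ t ∈ range T, ∑ a, G.cfrPolicy o t h x a *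
        G.cfLoss (G.cfrPolicy o t) (ν t) h x a - G.estBound h x * ι / η ≤
      ∑ t ∈ range T, ∑ a, G.cfrPolicy o t h x a * G.lossEst (o t h) h x a)
    {μ' : Strategy X A} (hμ' : IsPolicy H μ') :
    ∑ t ∈ range T, (G.pairing (G.cfrPolicy o t) (G.loss (ν t)) - G.pairing μ' (G.loss (ν t))) ≤
      4 * η * H ^ 2 * T +
        H * Fintype.card A * G.numInfosets * (2 * ι / η + ι + Fintype.card A / (2 * η)) := by
  set m := (Fintype.card A : ℝ) with hm
  set D := 2 * ι / η + ι + m / (2 * η) with hD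
  have hD0 : 0 ≤ D := by positivity
  have key : ∀ h ∈ range H, ∑ x, seqPre G.prevX μ' h x * ∑ t ∈ range T,
      ∑ a, (G.cfrPolicy o t h x a - μ' h x a) * G.cfLoss (G.cfrPolicy o t) (ν t) h x a ≤
      4 * η * (H * T) + H * m * Fintype.card (X h) * D := by
    intro h hh
    rw [mem_range] at hh
    have h1 : ∀ x, seqPre G.prevX μ' h x * ∑ t ∈ range T,
        ∑ a, (G.cfrPolicy o t h x a - μ' h x a) * G.cfLoss (G.cfrPolicy o t) (ν t) h x a ≤
        2 * η * (∑ t ∈ range T, seqPre G.prevX μ' h x *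
          ∑ a, G.cfrPolicy o t h x a * G.cfLoss (G.cfrPolicy o t) (ν t) h x a) +
        η * (∑ t ∈ range T, seqPre G.prevX μ' h x *
          ∑ a, μ' h x a * G.cfLoss (G.cfrPolicy o t) (ν t) h x a) +
        η * (∑ t ∈ range T, seqPre G.prevX μ' h x *
          ∑ a, 1 / m * G.cfLoss (G.cfrPolicy o t) (ν t) h x a) +
        seqPre G.prevX μ' h x * G.estBound h x * D := by
      intro x
      have := regretMatching_regret_le (R := fun t => G.cfrRegret o t h x)
        (l := fun t => G.lossEst (o t h) h x)
        (L := fun t => G.cfLoss (G.cfrPolicy o t) (ν t) h x) (hμ' h hh x) (fun a => rfl)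
        (fun t a => rfl)
        (fun t ht a => G.cfLoss_nonneg (G.isPolicy_cfrPolicy o t) (hν t ht) h x a)
        (G.estBound_pos hh x) hη hη1 (hl h hh x) (hup h hh x) (hup' h hh x) (hlow h hh x)
      refine (mul_le_mul_of_nonneg_left this (hμ'.seqPre_nonneg _ hh x)).trans_eq ?_
      simp only [← mul_sum]
      simp only [cfrPolicy, ← hm, ← hD]
      ring
    refine (sum_le_sum fun x _ => h1 x).trans ?_
    have h2 : ∀ ρ : ℕ → Strategy X A, (∀ t, IsPolicy H (ρ t)) →
        ∑ x, ∑ t ∈ range T, seqPre G.prevX μ' h x *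
          ∑ a, ρ t h x a * G.cfLoss (G.cfrPolicy o t) (ν t) h x a ≤ H * T := by
      intro ρ hρ
      rw [sum_comm]
      refine (sum_le_sum fun t ht => G.sum_seqPre_mul_cfLoss_le hμ' (hρ t)
        (G.isPolicy_cfrPolicy o t) (hν t (mem_range.1 ht)) h).trans_eq ?_
      simp [mul_comm]
    simp only [sum_add_distrib, ← mul_sum, ← sum_mul] at h2 ⊢
    -- The three first-order terms correspond to `ρ` being the played policy, the comparator and the
    -- uniform policy. Their coefficients `2 + 1 + 1` give the `4`.
    have a1 := h2 (G.cfrPolicy o) (G.isPolicy_cfrPolicy o)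
    have a2 := h2 (fun _ => μ') (fun _ => hμ')
    have a3 := h2 (fun _ => fun _ _ _ => 1 / (Fintype.card A : ℝ)) (fun _ => isPolicy_uniform)
    have a4 := mul_le_mul_of_nonneg_right (G.sum_seqPre_mul_estBound_le hμ' hh) hD0
    simp only [← mul_sum, ← hm] at a1 a2 a3 a4 ⊢
    have b1 := mul_le_mul_of_nonneg_left a1 (by positivity : 0 ≤ 2 * η)
    have b2 := mul_le_mul_of_nonneg_left a2 hη.le
    have b3 := mul_le_mul_of_nonneg_left a3 hη.le
    linarith
  calc _ = ∑ h ∈ range H, ∑ x, seqPre G.prevX μ' h x * ∑ t ∈ range T,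
      ∑ a, (G.cfrPolicy o t h x a - μ' h x a) * G.cfLoss (G.cfrPolicy o t) (ν t) h x a := by
        simp only [pairing_sub_pairing]
        rw [sum_comm]
        refine sum_congr rfl fun h _ => ?_
        rw [sum_comm]
        simp only [mul_sum]
    _ ≤ ∑ h ∈ range H, (4 * η * (H * T) + H * m * Fintype.card (X h) * D) := sum_le_sum key
    _ = _ := by
        simp only [sum_add_distrib, ← sum_mul, ← mul_sum, numInfosets, Nat.cast_sum, sum_const,
          card_range, nsmul_eq_mul]
        ring

end POMG

/-- The choice of the parameter of the concentration inequalities. -/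
lemma tuned_bound_le {H X m T ι b η : ℝ} (hH : 1 ≤ H) (hX : 1 ≤ X) (hm : 1 ≤ m) (hT : 1 ≤ T)
    (hι : 1 ≤ ι) (hb : b = √(H ^ 3 * X * m ^ 2 * T * ι)) (hη : η = b / (H ^ 2 * T)) (hη1 : η ≤ 1) :
    4 * η * H ^ 2 * T + H * m * X * (2 * ι / η + ι + m / (2 * η)) ≤ 8 * b := by
  have hb0 : 0 < b := by rw [hb]; positivity
  have hbb : b * b = H ^ 3 * X * m ^ 2 * T * ι := by rw [hb]; exact Real.mul_self_sqrt (by positivity)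
  have hη0 : 0 < η := by rw [hη]; positivity
  have h1 : 4 * η * H ^ 2 * T = 4 * b := by rw [hη]; field_simp
  -- The concentration term carries `m ι` and the Blackwell term below carries `m²` without `ι`. The
  -- product `m² ι` under the root dominates both.
  have h2 : H * m * X * (ι / η) ≤ b := by
    have : H * m * X * (ι / η) = H ^ 3 * X * m * T * ι / b := by rw [hη]; field_simp
    rw [this, div_le_iff₀ hb0, hbb]
    have : m ≤ m ^ 2 := by nlinarith
    gcongr
  have h3 : H * m * X * ι ≤ H * m * X * (ι / η) := by
    gcongr
    rw [le_div_iff₀ hη0]; nlinarith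
  have h4 : H * m * X * (m / (2 * η)) ≤ b / 2 := by
    have : H * m * X * (m / (2 * η)) = H ^ 3 * X * m ^ 2 * T / b / 2 := by rw [hη]; field_simp
    rw [this]
    refine div_le_div_of_nonneg_right ?_ (by norm_num)
    rw [div_le_iff₀ hb0, hbb]
    exact le_mul_of_one_le_right (by positivity) hι
  have h5 : H * m * X * (2 * ι / η + ι + m / (2 * η)) =
      2 * (H * m * X * (ι / η)) + H * m * X * ι + H * m * X * (m / (2 * η)) := by ring
  -- The multiples of `b` are `4 + 2 + 1 + 1/2 ≤ 8`.
  linarith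

/-! ### Concentration -/

section Concentration

variable {Ω : Type*} [mΩ : MeasurableSpace Ω] {P : Measure Ω} [IsProbabilityMeasure P]
  {𝓕 : Filtration ℕ mΩ}

lemma integrable_of_ae_abs_le {f : Ω → ℝ} (hf : AEStronglyMeasurable f P) {c : ℝ}
    (hc : ∀ᵐ ω ∂P, |f ω| ≤ c) : Integrable f P :=
  Integrable.of_bound hf c (by simpa only [Real.norm_eq_abs] using hc)

/-- The exponential supermartingale of a sum of bounded increments `w t`, compensated by a bound on
their conditional exponential moments. -/
theorem integral_exp_sum_sub_condExp_le {w y : ℕ → Ω → ℝ} {c : ℝ} {T : ℕ}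
    (hw : ∀ t < T, Measurable[𝓕 (t + 1)] (w t)) (hwc : ∀ t < T, ∀ᵐ ω ∂P, |w t ω| ≤ c)
    (hy : ∀ t < T, Measurable (y t)) (hyc : ∀ t < T, ∀ᵐ ω ∂P, |y t ω| ≤ c)
    (hwy : ∀ t < T, ∀ᵐ ω ∂P, Real.exp (w t ω) ≤ 1 + y t ω) {n : ℕ} (hn : n ≤ T) :
    Measurable[𝓕 n] (fun ω => Real.exp (∑ t ∈ range n, (w t ω - (P[y t | 𝓕 t]) ω))) ∧
    (∃ C, ∀ᵐ ω ∂P, Real.exp (∑ t ∈ range n, (w t ω - (P[y t | 𝓕 t]) ω)) ≤ C) ∧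
    ∫ ω, Real.exp (∑ t ∈ range n, (w t ω - (P[y t | 𝓕 t]) ω)) ∂P ≤ 1 := by
  induction n with
  | zero =>
    refine ⟨by simp, ⟨1, by simp⟩, by simp⟩
  | succ n ih =>
    obtain ⟨hm, ⟨C, hC⟩, hI⟩ := ih (by omega)
    have hnT : n < T := hn
    set d := P[y n | 𝓕 n] with hd
    have hdm : Measurable[𝓕 n] d := stronglyMeasurable_condExp.measurable
    have hdc : ∀ᵐ ω ∂P, |d ω| ≤ |c| := by
      have := ae_bdd_abs_condExp_of_ae_bdd_abs (m := 𝓕 n) (R := |c|) (μ := P) (f := y n)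
        ((hyc n hnT).mono fun ω h => h.trans (le_abs_self c))
      exact this
    set W := fun ω => Real.exp (∑ t ∈ range n, (w t ω - (P[y t | 𝓕 t]) ω)) with hW
    set g := fun ω => W ω * Real.exp (-d ω) with hg
    have hgm : Measurable[𝓕 n] g := hm.mul (Real.measurable_exp.comp hdm.neg)
    have hgc : ∀ᵐ ω ∂P, |g ω| ≤ C * Real.exp |c| := by
      filter_upwards [hC, hdc] with ω h1 h2
      have h3 : 0 < W ω := Real.exp_pos _
      rw [abs_of_pos (mul_pos h3 (Real.exp_pos _))]
      exact mul_le_mul h1 (Real.exp_le_exp.2 ((neg_le_abs _).trans h2)) (Real.exp_pos _).le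
        (h3.le.trans h1)
    have hstep : ∀ ω, Real.exp (∑ t ∈ range (n + 1), (w t ω - (P[y t | 𝓕 t]) ω)) =
        g ω * Real.exp (w n ω) := by
      intro ω
      rw [sum_range_succ, Real.exp_add, sub_eq_neg_add (w n ω), Real.exp_add (-_), ← mul_assoc]
    have hle := 𝓕.le n
    have hgI : Integrable g P :=
      integrable_of_ae_abs_le (hgm.mono hle le_rfl).aestronglyMeasurable hgc
    have hyI : Integrable (y n) P :=
      integrable_of_ae_abs_le (hy n hnT).aestronglyMeasurable (hyc n hnT)
    have hwm : Measurable (w n) := (hw n hnT).mono (𝓕.le _) le_rfl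
    have hgyI : Integrable (g * y n) P := by
      refine hyI.bdd_mul (c := C * Real.exp |c|) hgI.aestronglyMeasurable ?_
      simpa only [Real.norm_eq_abs] using hgc
    have hgdI : Integrable (g * d) P := by
      refine integrable_condExp.bdd_mul (c := C * Real.exp |c|) hgI.aestronglyMeasurable ?_
      simpa only [Real.norm_eq_abs] using hgc
    have hgw : ∀ᵐ ω ∂P, |g ω * Real.exp (w n ω)| ≤ C * Real.exp |c| * Real.exp c := by
      filter_upwards [hgc, hwc n hnT] with ω h1 h2
      rw [abs_mul, abs_of_pos (Real.exp_pos (w n ω))]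
      exact mul_le_mul h1 (Real.exp_le_exp.2 ((le_abs_self _).trans h2)) (Real.exp_pos _).le
        ((abs_nonneg _).trans h1)
    have hg0 : ∀ ω, 0 ≤ g ω := fun ω => mul_nonneg (Real.exp_pos _).le (Real.exp_pos _).le
    simp only [hstep]
    refine ⟨(hgm.mono (𝓕.mono (Nat.le_succ n)) le_rfl).mul (Real.measurable_exp.comp (hw n hnT)),
      ⟨_, hgw.mono fun ω h => (le_abs_self _).trans h⟩, ?_⟩
    -- The supermartingale step is `E[g e^w] ≤ E[g (1 + y)] = E[g (1 + d)] ≤ E[g e^d] = E[W]`, with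
    -- `d` the conditional mean of `y`.
    calc ∫ ω, g ω * Real.exp (w n ω) ∂P ≤ ∫ ω, (g ω + (g * y n) ω) ∂P := by
          refine integral_mono_ae (integrable_of_ae_abs_le (hgI.aestronglyMeasurable.mul
            (Real.measurable_exp.comp hwm).aestronglyMeasurable) hgw) (hgI.add hgyI) ?_
          filter_upwards [hwy n hnT] with ω h
          have := mul_le_mul_of_nonneg_left h (hg0 ω)
          simp only [Pi.mul_apply]
          linarith
      _ = ∫ ω, g ω ∂P + ∫ ω, (g * d) ω ∂P := by
          rw [integral_add hgI hgyI, ← integral_condExp hle (f := g * y n)]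
          congr 1
          exact integral_congr_ae (condExp_mul_of_stronglyMeasurable_left
            (hgm.stronglyMeasurable) hgyI hyI)
      _ = ∫ ω, (g ω + (g * d) ω) ∂P := (integral_add hgI hgdI).symm
      _ ≤ ∫ ω, W ω ∂P := by
          have hWI : Integrable W P := integrable_of_ae_abs_le
            (hm.mono hle le_rfl).aestronglyMeasurable
            (hC.mono fun ω h => (abs_of_pos (Real.exp_pos _)).trans_le h)
          refine integral_mono (hgI.add hgdI) hWI fun ω => ?_
          have h1 : W ω = g ω * Real.exp (d ω) := by
            change W ω = W ω * Real.exp (-d ω) * Real.exp (d ω)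
            rw [mul_assoc, ← Real.exp_add]; simp
          have h2 := mul_le_mul_of_nonneg_left (Real.add_one_le_exp (d ω)) (hg0 ω)
          simp only [Pi.mul_apply]
          linarith
      _ ≤ 1 := hI

/-- Markov's inequality for the exponential supermartingale. -/
lemma measure_le_sum_sub_condExp_le {w y : ℕ → Ω → ℝ} {c : ℝ} {T : ℕ}
    (hw : ∀ t < T, Measurable[𝓕 (t + 1)] (w t)) (hwc : ∀ t < T, ∀ᵐ ω ∂P, |w t ω| ≤ c)
    (hy : ∀ t < T, Measurable (y t)) (hyc : ∀ t < T, ∀ᵐ ω ∂P, |y t ω| ≤ c)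
    (hwy : ∀ t < T, ∀ᵐ ω ∂P, Real.exp (w t ω) ≤ 1 + y t ω) (ι : ℝ) :
    P {ω | ι ≤ ∑ t ∈ range T, (w t ω - (P[y t | 𝓕 t]) ω)} ≤ ENNReal.ofReal (Real.exp (-ι)) := by
  obtain ⟨hm, ⟨C, hC⟩, hI⟩ := integral_exp_sum_sub_condExp_le hw hwc hy hyc hwy le_rfl
  have hint := integrable_of_ae_abs_le (P := P) (hm.mono (𝓕.le T) le_rfl).aestronglyMeasurable
    (hC.mono fun ω h => (abs_of_pos (Real.exp_pos _)).trans_le h)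
  have := measure_ge_le_exp_mul_mgf (μ := P)
    (X := fun ω => ∑ t ∈ range T, (w t ω - (P[y t | 𝓕 t]) ω)) (t := 1) ι zero_le_one
    (by simpa only [one_mul] using hint)
  rw [← ofReal_measureReal]
  refine ENNReal.ofReal_le_ofReal (this.trans ?_)
  simp only [mgf, one_mul, neg_mul]
  exact mul_le_of_le_one_right (Real.exp_pos _).le hI

variable {z e : ℕ → Ω → ℝ} {K η : ℝ} {T : ℕ}

lemma sum_sub_condExp_eq (r s : ℝ) (he : ∀ t < T, P[z t | 𝓕 t] =ᵐ[P] e t) :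
    ∀ᵐ ω ∂P, ∑ t ∈ range T, ((fun ω => r * z t ω) ω - (P[fun ω => s * z t ω | 𝓕 t]) ω) =
      r * ∑ t ∈ range T, z t ω - s * ∑ t ∈ range T, e t ω := by
  have h1 : ∀ᵐ ω ∂P, ∀ t < T, (P[fun ω => s * z t ω | 𝓕 t]) ω = s * e t ω := by
    rw [ae_all_iff]
    intro t
    by_cases ht : t < T
    · filter_upwards [he t ht, condExp_smul (μ := P) s (z t) (𝓕 t)] with ω h1 h2 _
      rw [← h1]
      exact h2
    · exact Filter.Eventually.of_forall fun _ h => absurd h ht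
  filter_upwards [h1] with ω h
  rw [mul_sum, mul_sum, ← sum_sub_distrib]
  exact sum_congr rfl fun t ht => by rw [h t (mem_range.1 ht)]

/-- An upper tail bound for sums of nonnegative bounded variables in terms of the sum of their
conditional expectations. -/
theorem measure_sum_gt_le (hz : ∀ t < T, Measurable[𝓕 (t + 1)] (z t)) (hK : 0 < K)
    (hzK : ∀ t < T, ∀ᵐ ω ∂P, z t ω ∈ Set.Icc 0 K) (he : ∀ t < T, P[z t | 𝓕 t] =ᵐ[P] e t)
    (hη : 0 < η) (hη1 : η ≤ 1) (ι : ℝ) :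
    P {ω | (1 + η) * ∑ t ∈ range T, e t ω + K * ι / η < ∑ t ∈ range T, z t ω} ≤
      ENNReal.ofReal (Real.exp (-ι)) := by
  have hu : ∀ t < T, ∀ᵐ ω ∂P, η / K * z t ω ∈ Set.Icc 0 η := fun t ht =>
    (hzK t ht).mono fun ω h => ⟨mul_nonneg (by positivity) h.1, by
      rw [div_mul_eq_mul_div, div_le_iff₀ hK]; exact mul_le_mul_of_nonneg_left h.2 hη.le⟩
  -- With `u = η z / K ∈ [0, η]`, `e^u ≤ 1 + u + u² ≤ 1 + (1 + η) u`: the second moment is absorbed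
  -- into the mean.
  have := measure_le_sum_sub_condExp_le (P := P) (𝓕 := 𝓕) (T := T) (c := 2)
    (w := fun t ω => η / K * z t ω) (y := fun t ω => (1 + η) * (η / K) * z t ω)
    (fun t ht => (hz t ht).const_mul _)
    (fun t ht => (hu t ht).mono fun ω h => by rw [abs_of_nonneg h.1]; linarith [h.2])
    (fun t ht => ((hz t ht).mono (𝓕.le _) le_rfl).const_mul _)
    (fun t ht => (hu t ht).mono fun ω h => by
      rw [mul_assoc, abs_of_nonneg (mul_nonneg (by linarith) h.1)]; nlinarith [h.1, h.2])
    (fun t ht => (hu t ht).mono fun ω h => by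
      have h1 := (abs_le.1 (Real.abs_exp_sub_one_sub_id_le (x := η / K * z t ω)
        (by rw [abs_of_nonneg h.1]; linarith [h.2]))).2
      rw [mul_assoc]
      nlinarith [h.1, h.2]) ι
  refine (measure_mono_ae ?_).trans this
  filter_upwards [sum_sub_condExp_eq (η / K) ((1 + η) * (η / K)) he] with ω h hω
  change ι ≤ _
  refine le_of_le_of_eq ?_ h.symm
  change (1 + η) * ∑ t ∈ range T, e t ω + K * ι / η < ∑ t ∈ range T, z t ω at hω
  have h2 := mul_lt_mul_of_pos_left hω (show 0 < η / K by positivity)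
  have h3 : η / K * ((1 + η) * ∑ t ∈ range T, e t ω + K * ι / η) =
    (1 + η) * (η / K) * ∑ t ∈ range T, e t ω + ι := by field_simp
  linarith

/-- The corresponding lower tail bound. -/
theorem measure_sum_lt_le (hz : ∀ t < T, Measurable[𝓕 (t + 1)] (z t)) (hK : 0 < K)
    (hzK : ∀ t < T, ∀ᵐ ω ∂P, z t ω ∈ Set.Icc 0 K) (he : ∀ t < T, P[z t | 𝓕 t] =ᵐ[P] e t)
    (hη : 0 < η) (hη1 : η ≤ 1) (ι : ℝ) :
    P {ω | ∑ t ∈ range T, z t ω < (1 - η) * ∑ t ∈ range T, e t ω - K * ι / η} ≤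
      ENNReal.ofReal (Real.exp (-ι)) := by
  have hu : ∀ t < T, ∀ᵐ ω ∂P, η / K * z t ω ∈ Set.Icc 0 η := fun t ht =>
    (hzK t ht).mono fun ω h => ⟨mul_nonneg (by positivity) h.1, by
      rw [div_mul_eq_mul_div, div_le_iff₀ hK]; exact mul_le_mul_of_nonneg_left h.2 hη.le⟩
  -- Likewise `e^{-u} ≤ 1 - u + u² ≤ 1 - (1 - η) u`.
  have := measure_le_sum_sub_condExp_le (P := P) (𝓕 := 𝓕) (T := T) (c := 2)
    (w := fun t ω => -(η / K) * z t ω) (y := fun t ω => -((1 - η) * (η / K)) * z t ω)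
    (fun t ht => (hz t ht).const_mul _)
    (fun t ht => (hu t ht).mono fun ω h => by
      rw [neg_mul, abs_neg, abs_of_nonneg h.1]; linarith [h.2])
    (fun t ht => ((hz t ht).mono (𝓕.le _) le_rfl).const_mul _)
    (fun t ht => (hu t ht).mono fun ω h => by
      rw [neg_mul, abs_neg, mul_assoc, abs_of_nonneg (mul_nonneg (by linarith) h.1)]
      nlinarith [h.1, h.2])
    (fun t ht => (hu t ht).mono fun ω h => by
      have h1 := (abs_le.1 (Real.abs_exp_sub_one_sub_id_le (x := -(η / K * z t ω))
        (by rw [abs_neg, abs_of_nonneg h.1]; linarith [h.2]))).2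
      rw [neg_mul, neg_mul, mul_assoc]
      nlinarith [h.1, h.2]) ι
  refine (measure_mono_ae ?_).trans this
  filter_upwards [sum_sub_condExp_eq (-(η / K)) (-((1 - η) * (η / K))) he] with ω h hω
  change ι ≤ _
  refine le_of_le_of_eq ?_ h.symm
  change ∑ t ∈ range T, z t ω < (1 - η) * ∑ t ∈ range T, e t ω - K * ι / η at hω
  have h2 := mul_lt_mul_of_pos_left hω (show 0 < η / K by positivity)
  have h3 : η / K * ((1 - η) * ∑ t ∈ range T, e t ω - K * ι / η) =
    (1 - η) * (η / K) * ∑ t ∈ range T, e t ω - ι := by field_simp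
  linarith

end Concentration

/-! ### The loss estimators -/

namespace POMG

variable {H : ℕ} {S X Y : ℕ → Type*} {A B : Type*} [∀ h, Fintype (S h)] [∀ h, Fintype (X h)]
  [Fintype A] [Fintype B]

instance (G : POMG H S X Y A B) (z : StatePath H S A B) : IsProbabilityMeasure (G.rewardLaw z) := by
  unfold rewardLaw; infer_instance

lemma ae_rewardLaw_mem (G : POMG H S X Y A B) (z : StatePath H S A B) :
    ∀ᵐ r ∂G.rewardLaw z, ∀ k, r k ∈ Set.Icc (0 : ℝ) 1 :=
  ae_all_iff.2 fun k => (measurePreserving_eval (fun k : Fin H =>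
    (G.reward k (z k).1 (z k).2.1 (z k).2.2 : Measure ℝ)) k).quasiMeasurePreserving.ae
    (G.ae_reward_mem k _ _ _)

lemma integrable_rewardLaw_eval (G : POMG H S X Y A B) (z : StatePath H S A B) (k : Fin H) :
    Integrable (fun r => r k) (G.rewardLaw z) :=
  (measurePreserving_eval (fun k : Fin H =>
    (G.reward k (z k).1 (z k).2.1 (z k).2.2 : Measure ℝ)) k).integrable_comp_of_integrable
    (G.integrable_reward k _ _ _)

lemma integral_rewardLaw_eval (G : POMG H S X Y A B) (z : StatePath H S A B) (k : Fin H) :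
    ∫ r, r k ∂G.rewardLaw z = G.meanReward k (z k).1 (z k).2.1 (z k).2.2 := by
  have hp := measurePreserving_eval (fun k : Fin H =>
    (G.reward k (z k).1 (z k).2.1 (z k).2.2 : Measure ℝ)) k
  rw [meanReward, ← hp.map_eq, integral_map hp.measurable.aemeasurable (by fun_prop)]
  rfl

lemma card_filter_le (H h : ℕ) (hh : h < H) :
    ((univ.filter fun k : Fin H => h ≤ k.1).card : ℝ) = (H : ℝ) - h := by
  have : (univ.filter fun k : Fin H => h ≤ k.1) = Ici (⟨h, hh⟩ : Fin H) := by
    ext k; simp [Fin.le_def]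
  rw [this, Fin.card_Ici, Nat.cast_sub hh.le]

open Classical in
lemma lossEst_eq (G : POMG H S X Y A B) (o : Obs H X A) {h : ℕ} (hh : h < H) (x : X h) (a : A) :
    G.lossEst o h x a = (if (o ⟨h, hh⟩).1 = x ∧ (o ⟨h, hh⟩).2.1 = a then 1 else 0) /
      seqForm G.prevX (G.balanced h) h x a * ∑ k : Fin H with h ≤ k.1, (1 - (o k).2.2) := by
  rw [lossEst, dif_pos hh, sum_sub_distrib, sum_const, nsmul_eq_mul, mul_one, card_filter_le H h hh]

open Classical in
lemma lossEst_observe (G : POMG H S X Y A B) (z : StatePath H S A B) (r : Fin H → ℝ) {h : ℕ}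
    (hh : h < H) (x : X h) (a : A) : G.lossEst (G.observe z r) h x a =
      (if G.obsX h (z ⟨h, hh⟩).1 = x ∧ (z ⟨h, hh⟩).2.1 = a then 1 else 0) /
        seqForm G.prevX (G.balanced h) h x a * ∑ k : Fin H with h ≤ k.1, (1 - r k) :=
  G.lossEst_eq (G.observe z r) hh x a

lemma lossEst_mem_Icc [Nonempty A] [Nonempty B] (G : POMG H S X Y A B) {o : Obs H X A}
    (ho : ∀ k, (o k).2.2 ∈ Set.Icc (0 : ℝ) 1) {h : ℕ} (hh : h < H) (x : X h) (a : A) :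
    G.lossEst o h x a ∈ Set.Icc 0 (G.estBound h x) := by
  classical
  have h0 := G.seqForm_balanced_pos hh x a
  have hs0 : 0 ≤ ∑ k : Fin H with h ≤ k.1, (1 - (o k).2.2) :=
    sum_nonneg fun k _ => sub_nonneg.2 (ho k).2
  have hs1 : ∑ k : Fin H with h ≤ k.1, (1 - (o k).2.2) ≤ H := by
    calc _ ≤ ∑ k : Fin H with h ≤ k.1, (1 : ℝ) := sum_le_sum fun k _ => by linarith [(ho k).1]
      _ = (H : ℝ) - h := by rw [sum_const, nsmul_eq_mul, mul_one, card_filter_le H h hh]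
      _ ≤ H := by linarith [(Nat.cast_nonneg h : (0 : ℝ) ≤ h)]
  rw [G.lossEst_eq o hh]
  refine ⟨mul_nonneg (div_nonneg (by split_ifs <;> simp) h0.le) hs0, ?_⟩
  -- The factor `A` comes from the uniform action in layer `h` itself.
  have : G.estBound h x = 1 / seqForm G.prevX (G.balanced h) h x a * H := by
    rw [seqForm_balanced, estBound, one_div_div]; ring
  rw [this]
  refine mul_le_mul ?_ hs1 hs0 (by positivity)
  gcongr
  split_ifs <;> simp

lemma measurable_lossEst (G : POMG H S X Y A B) (z : StatePath H S A B) (h : ℕ) (x : X h) (a : A) :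
    Measurable fun r => G.lossEst (G.observe z r) h x a := by
  classical
  by_cases hh : h < H
  · simp only [G.lossEst_observe _ _ hh]
    exact (Finset.measurable_fun_sum _ fun k _ => by fun_prop).const_mul _
  · simp only [lossEst, dif_neg hh]
    exact measurable_const

lemma integrable_lossEst [Nonempty A] [Nonempty B] (G : POMG H S X Y A B) (z : StatePath H S A B)
    {h : ℕ} (hh : h < H) (x : X h) (a : A) :
    Integrable (fun r => G.lossEst (G.observe z r) h x a) (G.rewardLaw z) :=
  integrable_of_ae_abs_le (G.measurable_lossEst z h x a).aestronglyMeasurable <| by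
    filter_upwards [G.ae_rewardLaw_mem z] with r hr
    have := G.lossEst_mem_Icc (o := G.observe z r) hr hh x a
    rw [abs_of_nonneg this.1]
    exact this.2

/-- The estimators are unbiased. -/
theorem sum_pathProb_integral_lossEst [Nonempty A] [Nonempty B] (G : POMG H S X Y A B)
    {μ : Strategy X A} {ν : Strategy Y B} (hμ : IsPolicy H μ) (hν : IsPolicy H ν) {h : ℕ} (hh : h < H)
    (x : X h) (a : A) :
    ∑ z, G.pathProb (G.mix h μ) ν z * ∫ r, G.lossEst (G.observe z r) h x a ∂G.rewardLaw z =
      G.cfLoss μ ν h x a := by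
  classical
  rw [← G.sum_pathProb_mix hμ hν hh x a (G.seqForm_balanced_pos hh x a).ne']
  refine sum_congr rfl fun z _ => ?_
  congr 1
  simp only [G.lossEst_observe _ _ hh]
  have hint : ∀ k, Integrable (fun r : Fin H → ℝ => 1 - r k) (G.rewardLaw z) := fun k =>
    (integrable_const 1).sub (G.integrable_rewardLaw_eval z k)
  rw [integral_const_mul, integral_finsetSum _ fun k _ => hint k]
  congr 1
  refine sum_congr rfl fun k _ => ?_
  rw [integral_sub (integrable_const 1) (G.integrable_rewardLaw_eval z k),
    G.integral_rewardLaw_eval z k]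
  simp

end POMG

lemma measurable_regretMatching {A : Type*} [Fintype A] {Ω : Type*} {mΩ : MeasurableSpace Ω}
    {R : Ω → A → ℝ} (hR : ∀ a, Measurable fun ω => R ω a) (a : A) :
    Measurable fun ω => regretMatching (R ω) a := by
  classical
  refine Measurable.ite ?_ measurable_const (by fun_prop)
  rw [Set.ofPred_forall]
  exact MeasurableSet.iInter fun a' => measurableSet_le (hR a') measurable_const

/-! ### Playing against an adaptive opponent -/

namespace POMG.IsCFRPlay

variable {H : ℕ} {S X Y : ℕ → Type*} {A B : Type*} [∀ h, Fintype (S h)] [∀ h, Fintype (X h)]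
  [Fintype A] [Fintype B] {Ω : Type*} [mΩ : MeasurableSpace Ω] {P : Measure Ω}
  {T : ℕ} {G : POMG H S X Y A B} {𝓕 : Filtration ℕ mΩ} {ν : ℕ → Ω → Strategy Y B}
  {path : ℕ → ℕ → Ω → StatePath H S A B} {rew : ℕ → ℕ → Ω → Fin H → ℝ}

lemma sum_indicator_path (f : StatePath H S A B → Ω → ℝ) (t h : ℕ) (ω : Ω) :
    ∑ z, {ω | path t h ω = z}.indicator (f z) ω = f (path t h ω) ω := by
  classical
  rw [sum_eq_single (path t h ω)]
  · simp
  · intro z _ hz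
    exact Set.indicator_of_notMem (show ω ∉ {ω | path t h ω = z} from fun e => hz (Eq.symm e)) _
  · simp

/-- The path enters only through its finitely many fibres `{path t h = z}`, which are measurable by
hypothesis. On each fibre the estimator is a measurable function of the rewards. -/
lemma measurable_lossEst (hp : G.IsCFRPlay P T 𝓕 ν path rew) {t : ℕ} (ht : t < T) {h : ℕ} (hh : h < H)
    (x : X h) (a : A) :
    Measurable[𝓕 (t + 1)] fun ω => G.lossEst (G.observations path rew ω t h) h x a := by
  have : (fun ω => G.lossEst (G.observations path rew ω t h) h x a) = fun ω =>
      ∑ z, {ω | path t h ω = z}.indicator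
        (fun ω => G.lossEst (G.observe z (rew t h ω)) h x a) ω := by
    funext ω
    rw [sum_indicator_path (fun z ω => G.lossEst (G.observe z (rew t h ω)) h x a) t h ω]
    rfl
  rw [this]
  exact Finset.measurable_fun_sum _ fun z _ =>
    ((G.measurable_lossEst z h x a).comp (hp.measurable_rew t ht h hh)).indicator
      (hp.measurable_path t ht h hh z)

/-- The regrets before round `t` use only earlier rounds. Hence `μ^t` is predictable and may be
treated as a constant given `𝓕 t`. -/
lemma measurable_cfrRegret (hp : G.IsCFRPlay P T 𝓕 ν path rew) {t : ℕ} (ht : t ≤ T) {h : ℕ}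
    (hh : h < H) (x : X h) (a : A) :
    Measurable[𝓕 t] fun ω => G.cfrRegret (G.observations path rew ω) t h x a := by
  induction t generalizing a with
  | zero => exact measurable_const
  | succ t ih =>
    have ht' : t < T := ht
    have hR : ∀ a, Measurable[𝓕 (t + 1)] fun ω => G.cfrRegret (G.observations path rew ω) t h x a :=
      fun a => (ih ht'.le a).mono (𝓕.mono (Nat.le_succ t)) le_rfl
    simp only [cfrRegret]
    refine (hR a).add (Measurable.sub ?_ (hp.measurable_lossEst ht' hh x a))
    exact Finset.measurable_fun_sum _ fun a' _ =>
      (measurable_regretMatching hR a').mul (hp.measurable_lossEst ht' hh x a')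

lemma measurable_cfrPolicy (hp : G.IsCFRPlay P T 𝓕 ν path rew) {t : ℕ} (ht : t ≤ T) {h : ℕ}
    (hh : h < H) (x : X h) (a : A) :
    Measurable[𝓕 t] fun ω => G.cfrPolicy (G.observations path rew ω) t h x a :=
  measurable_regretMatching (fun a => hp.measurable_cfrRegret ht hh x a) a

variable [IsProbabilityMeasure P]

lemma condExp_episode (hp : G.IsCFRPlay P T 𝓕 ν path rew) {t : ℕ} (ht : t < T) {h : ℕ} (hh : h < H)
    (z : StatePath H S A B) {E : Set (Fin H → ℝ)} (hE : MeasurableSet E) :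
    P[{ω | path t h ω = z ∧ rew t h ω ∈ E}.indicator (fun _ => (1 : ℝ)) | 𝓕 t] =ᵐ[P]
      fun ω => G.pathProb (G.mix h (G.cfrPolicy (G.observations path rew ω) t)) (ν t ω) z *
        (G.rewardLaw z).real E := by
  have := hp.law t ht h hh z E hE
  simpa [roundPolicies] using this

/-- Given the information before round `t`, the rewards on the event that episode `h` follows the
path `z` are distributed as `rewardLaw z`. -/
lemma condExp_indicator_comp_rew (hp : G.IsCFRPlay P T 𝓕 ν path rew) {t : ℕ} (ht : t < T) {h : ℕ}
    (hh : h < H) (z : StatePath H S A B) {f : (Fin H → ℝ) → ℝ} (hf : Measurable f)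
    (hfi : Integrable f (G.rewardLaw z)) :
    Integrable ({ω | path t h ω = z}.indicator fun ω => f (rew t h ω)) P ∧
    P[{ω | path t h ω = z}.indicator (fun ω => f (rew t h ω)) | 𝓕 t] =ᵐ[P]
      fun ω => G.pathProb (G.mix h (G.cfrPolicy (G.observations path rew ω) t)) (ν t ω) z *
        ∫ r, f r ∂G.rewardLaw z := by
  set p := fun ω => G.pathProb (G.mix h (G.cfrPolicy (G.observations path rew ω) t)) (ν t ω) z
    with hpdef
  have hle := 𝓕.le t
  have hpath : MeasurableSet {ω | path t h ω = z} := 𝓕.le _ _ (hp.measurable_path t ht h hh z)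
  have hrew : Measurable (rew t h) := (hp.measurable_rew t ht h hh).mono (𝓕.le _) le_rfl
  -- Taking all reward vectors as `E` identifies `p` with a conditional probability. This yields its
  -- integrability, measurability and sign almost surely.
  have hpc : P[{ω | path t h ω = z ∧ rew t h ω ∈ Set.univ}.indicator (fun _ => (1 : ℝ)) | 𝓕 t]
      =ᵐ[P] p := by
    filter_upwards [hp.condExp_episode ht hh z MeasurableSet.univ] with ω hω
    rw [hω]; simp [hpdef]
  have hpi : Integrable p P := integrable_condExp.congr hpc
  have hpm : AEStronglyMeasurable[𝓕 t] p P :=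
    stronglyMeasurable_condExp.aestronglyMeasurable.congr hpc
  have hp0 : 0 ≤ᵐ[P] p := by
    filter_upwards [hpc, condExp_nonneg (μ := P) (m := 𝓕 t)
      (f := {ω | path t h ω = z ∧ rew t h ω ∈ Set.univ}.indicator (fun _ => (1 : ℝ)))
      (Filter.Eventually.of_forall fun ω => Set.indicator_nonneg (fun _ _ => zero_le_one) ω)]
      with ω h1 h2
    rw [← h1]; exact h2
  -- The hypothesis on events `E` becomes an identity of measures, from which integrals of arbitrary
  -- integrable `f` can be computed.
  have hmap : ∀ s, MeasurableSet[𝓕 t] s →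
      (P.restrict (s ∩ {ω | path t h ω = z})).map (rew t h) =
        ENNReal.ofReal (∫ ω in s, p ω ∂P) • G.rewardLaw z := by
    intro s hs
    ext E hE
    have hmeas : MeasurableSet {ω | path t h ω = z ∧ rew t h ω ∈ E} := hpath.inter (hrew hE)
    rw [Measure.map_apply hrew hE, Measure.restrict_apply (hrew hE), Measure.smul_apply, smul_eq_mul]
    have h1 : ∫ ω in s, {ω | path t h ω = z ∧ rew t h ω ∈ E}.indicator (fun _ => (1 : ℝ)) ω ∂P =
        (∫ ω in s, p ω ∂P) * (G.rewardLaw z).real E := by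
      rw [← setIntegral_condExp hle ((integrable_const 1).indicator hmeas) hs,
        setIntegral_congr_ae (hle s hs) ((hp.condExp_episode ht hh z hE).mono fun ω h _ => h),
        integral_mul_const]
    have h2 : rew t h ⁻¹' E ∩ (s ∩ {ω | path t h ω = z}) =
        {ω | path t h ω = z ∧ rew t h ω ∈ E} ∩ s := by
      ext ω; simp only [Set.mem_inter_iff, Set.mem_preimage, Set.mem_ofPred_eq]; tauto
    rw [h2, ← Measure.restrict_apply hmeas, ← ofReal_measureReal (s := E), ← ENNReal.ofReal_mul
      (integral_nonneg_of_ae (ae_restrict_of_ae hp0)), ← h1, integral_indicator_const _ hmeas]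
    simp
  have hI : Integrable ({ω | path t h ω = z}.indicator fun ω => f (rew t h ω)) P := by
    rw [integrable_indicator_iff hpath, IntegrableOn]
    have h1 := hmap Set.univ MeasurableSet.univ
    rw [Set.univ_inter] at h1
    refine Integrable.comp_measurable (f := rew t h) (g := f) ?_ hrew
    rw [h1]
    exact hfi.smul_measure ENNReal.ofReal_ne_top
  refine ⟨hI, ?_⟩
  symm
  refine ae_eq_condExp_of_forall_setIntegral_eq hle hI (fun s _ _ => (hpi.mul_const _).integrableOn)
    (fun s hs _ => ?_) (hpm.mul aestronglyMeasurable_const)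
  rw [integral_mul_const, setIntegral_indicator hpath]
  have h1 : ∫ ω in s ∩ {ω | path t h ω = z}, f (rew t h ω) ∂P =
      ∫ r, f r ∂((P.restrict (s ∩ {ω | path t h ω = z})).map (rew t h)) :=
    (integral_map hrew.aemeasurable hf.aestronglyMeasurable).symm
  rw [h1, hmap s hs, integral_smul_measure, ENNReal.toReal_ofReal
    (integral_nonneg_of_ae (ae_restrict_of_ae hp0)), smul_eq_mul]

lemma ae_rew_mem (hp : G.IsCFRPlay P T 𝓕 ν path rew) :
    ∀ᵐ ω ∂P, ∀ t < T, ∀ h < H, ∀ k, rew t h ω k ∈ Set.Icc (0 : ℝ) 1 := by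
  rw [ae_all_iff]; intro t
  by_cases ht : t < T; swap
  · exact Filter.Eventually.of_forall fun _ e => absurd e ht
  have : ∀ᵐ ω ∂P, ∀ h, h < H → ∀ k, rew t h ω k ∈ Set.Icc (0 : ℝ) 1 := by
    rw [ae_all_iff]; intro h
    by_cases hh : h < H; swap
    · exact Filter.Eventually.of_forall fun _ e => absurd e hh
    set E : Set (Fin H → ℝ) := {r | ∀ k, r k ∈ Set.Icc (0 : ℝ) 1} with hEdef
    have hE : MeasurableSet E := by
      rw [hEdef, Set.ofPred_forall]
      exact MeasurableSet.iInter fun k => measurable_pi_apply k measurableSet_Icc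
    have hz : ∀ z, P {ω | path t h ω = z ∧ rew t h ω ∈ Eᶜ} = 0 := by
      intro z
      have hmeas : MeasurableSet {ω | path t h ω = z ∧ rew t h ω ∈ Eᶜ} :=
        MeasurableSet.inter (𝓕.le _ _ (hp.measurable_path t ht h hh z))
          ((hp.measurable_rew t ht h hh).mono (𝓕.le _) le_rfl hE.compl)
      have h0 : (G.rewardLaw z).real Eᶜ = 0 := by
        rw [measureReal_def, (G.ae_rewardLaw_mem z : G.rewardLaw z Eᶜ = 0)]; rfl
      have h1 := integral_congr_ae (hp.condExp_episode ht hh z hE.compl)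
      rw [integral_condExp (𝓕.le t), integral_indicator_const _ hmeas, h0] at h1
      simpa [measureReal_eq_zero_iff] using h1
    have : ∀ᵐ ω ∂P, ∀ z, ¬ (path t h ω = z ∧ rew t h ω ∈ Eᶜ) :=
      ae_all_iff.2 fun z => by simpa [ae_iff] using hz z
    filter_upwards [this] with ω hω _
    by_contra hc
    exact hω _ ⟨rfl, hc⟩
  filter_upwards [this] with ω hω _
  exact hω

lemma ae_lossEst_mem [Nonempty A] [Nonempty B] (hp : G.IsCFRPlay P T 𝓕 ν path rew) :
    ∀ᵐ ω ∂P, ∀ h < H, ∀ x, ∀ t < T, ∀ a,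
      G.lossEst (G.observations path rew ω t h) h x a ∈ Set.Icc 0 (G.estBound h x) := by
  filter_upwards [hp.ae_rew_mem] with ω hω h hh x t ht a
  exact G.lossEst_mem_Icc (fun k => hω t ht h hh k) hh x a

lemma integrable_lossEst [Nonempty A] [Nonempty B] (hp : G.IsCFRPlay P T 𝓕 ν path rew) {t : ℕ}
    (ht : t < T) {h : ℕ} (hh : h < H) (x : X h) (a : A) :
    Integrable (fun ω => G.lossEst (G.observations path rew ω t h) h x a) P :=
  integrable_of_ae_abs_le
    ((hp.measurable_lossEst ht hh x a).mono (𝓕.le _) le_rfl).aestronglyMeasurable <| by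
    filter_upwards [hp.ae_lossEst_mem] with ω hω
    rw [abs_of_nonneg (hω h hh x t ht a).1]
    exact (hω h hh x t ht a).2

theorem condExp_lossEst [Nonempty A] [Nonempty B] (hp : G.IsCFRPlay P T 𝓕 ν path rew) {t : ℕ}
    (ht : t < T) {h : ℕ} (hh : h < H) (x : X h) (a : A) :
    P[fun ω => G.lossEst (G.observations path rew ω t h) h x a | 𝓕 t] =ᵐ[P]
      fun ω => G.cfLoss (G.cfrPolicy (G.observations path rew ω) t) (ν t ω) h x a := by
  have h1 : (fun ω => G.lossEst (G.observations path rew ω t h) h x a) =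
      ∑ z, {ω | path t h ω = z}.indicator
        (fun ω => G.lossEst (G.observe z (rew t h ω)) h x a) := by
    funext ω
    rw [Finset.sum_apply,
      sum_indicator_path (fun z ω => G.lossEst (G.observe z (rew t h ω)) h x a) t h ω]
    rfl
  have h2 := fun z => hp.condExp_indicator_comp_rew ht hh z (G.measurable_lossEst z h x a)
    (G.integrable_lossEst z hh x a)
  rw [h1]
  refine (condExp_finsetSum (fun z _ => (h2 z).1) _).trans ?_
  filter_upwards [ae_all_iff.2 fun z => (h2 z).2] with ω hω
  rw [Finset.sum_apply, sum_congr rfl fun z _ => hω z]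
  exact G.sum_pathProb_integral_lossEst (G.isPolicy_cfrPolicy _ t) (hp.isPolicy t ht ω) hh x a

theorem condExp_sum_policy_mul_lossEst [Nonempty A] [Nonempty B]
    (hp : G.IsCFRPlay P T 𝓕 ν path rew) {t : ℕ} (ht : t < T) {h : ℕ} (hh : h < H) (x : X h) :
    P[fun ω => ∑ a, G.cfrPolicy (G.observations path rew ω) t h x a *
        G.lossEst (G.observations path rew ω t h) h x a | 𝓕 t] =ᵐ[P]
      fun ω => ∑ a, G.cfrPolicy (G.observations path rew ω) t h x a *
        G.cfLoss (G.cfrPolicy (G.observations path rew ω) t) (ν t ω) h x a := by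
  set p := fun a ω => G.cfrPolicy (G.observations path rew ω) t h x a with hpdef
  set l := fun a ω => G.lossEst (G.observations path rew ω t h) h x a with hldef
  have h1 : (fun ω => ∑ a, p a ω * l a ω) = ∑ a, p a * l a := by
    funext ω; simp
  have hpm : ∀ a, Measurable[𝓕 t] (p a) := fun a => hp.measurable_cfrPolicy ht.le hh x a
  have hint : ∀ a, Integrable (p a * l a) P := fun a => by
    refine (hp.integrable_lossEst ht hh x a).bdd_mul (c := 1)
      ((hpm a).mono (𝓕.le t) le_rfl).aestronglyMeasurable (Filter.Eventually.of_forall fun ω => ?_)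
    have := (G.isPolicy_cfrPolicy (G.observations path rew ω) t) h hh x
    rw [Real.norm_eq_abs, abs_of_nonneg (this.1 a), ← this.2]
    exact single_le_sum (fun a _ => this.1 a) (mem_univ a)
  change P[fun ω => ∑ a, p a ω * l a ω | 𝓕 t] =ᵐ[P] _
  rw [h1]
  refine (condExp_finsetSum (fun a _ => hint a) _).trans ?_
  have h2 : ∀ᵐ ω ∂P, ∀ a, (P[p a * l a | 𝓕 t]) ω = p a ω * (P[l a | 𝓕 t]) ω := ae_all_iff.2 fun a =>
    condExp_mul_of_stronglyMeasurable_left (hpm a).stronglyMeasurable (hint a)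
      (hp.integrable_lossEst ht hh x a)
  filter_upwards [h2, ae_all_iff.2 fun a => hp.condExp_lossEst ht hh x a] with ω h3 h4
  rw [Finset.sum_apply]
  exact sum_congr rfl fun a _ => by rw [h3, h4]

/-- The estimators at the infoset `x` concentrate around the counterfactual losses. -/
def Concentrates (G : POMG H S X Y A B) (T : ℕ) (o : ℕ → ℕ → Obs H X A) (ν : ℕ → Strategy Y B)
    (η ι : ℝ) (h : ℕ) (x : X h) : Prop :=
  (∀ a, ∑ t ∈ range T, G.lossEst (o t h) h x a ≤
    (1 + η) * ∑ t ∈ range T, G.cfLoss (G.cfrPolicy o t) (ν t) h x a + G.estBound h x * ι / η) ∧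
  ∑ t ∈ range T, ∑ a, G.cfrPolicy o t h x a * G.lossEst (o t h) h x a ≤
    (1 + η) * ∑ t ∈ range T, ∑ a, G.cfrPolicy o t h x a *
      G.cfLoss (G.cfrPolicy o t) (ν t) h x a + G.estBound h x * ι / η ∧
  (1 - η) * ∑ t ∈ range T, ∑ a, G.cfrPolicy o t h x a *
      G.cfLoss (G.cfrPolicy o t) (ν t) h x a - G.estBound h x * ι / η ≤
    ∑ t ∈ range T, ∑ a, G.cfrPolicy o t h x a * G.lossEst (o t h) h x a

/-- Union bound over `A` upper tails for single actions, plus one upper and one lower tail for the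
played average. -/
lemma measure_not_concentrates_le [Nonempty A] [Nonempty B] (hp : G.IsCFRPlay P T 𝓕 ν path rew)
    {η : ℝ} (hη : 0 < η) (hη1 : η ≤ 1) (ι : ℝ) {h : ℕ} (hh : h < H) (x : X h) :
    P {ω | ¬ Concentrates G T (G.observations path rew ω) (fun t => ν t ω) η ι h x} ≤
      ENNReal.ofReal ((Fintype.card A + 2) * Real.exp (-ι)) := by
  have hK := G.estBound_pos hh x
  have m1 : ∀ t < T, Measurable[𝓕 (t + 1)] fun ω =>
      ∑ a, G.cfrPolicy (G.observations path rew ω) t h x a *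
        G.lossEst (G.observations path rew ω t h) h x a := fun t ht =>
    Finset.measurable_fun_sum _ fun a _ =>
      ((hp.measurable_cfrPolicy ht.le hh x a).mono (𝓕.mono (Nat.le_succ t)) le_rfl).mul
        (hp.measurable_lossEst ht hh x a)
  have b1 : ∀ t < T, ∀ᵐ ω ∂P, ∑ a, G.cfrPolicy (G.observations path rew ω) t h x a *
        G.lossEst (G.observations path rew ω t h) h x a ∈ Set.Icc 0 (G.estBound h x) := by
    intro t ht
    filter_upwards [hp.ae_lossEst_mem] with ω hω
    have hs := (G.isPolicy_cfrPolicy (G.observations path rew ω) t) h hh x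
    refine ⟨sum_nonneg fun a _ => mul_nonneg (hs.1 a) (hω h hh x t ht a).1, ?_⟩
    calc _ ≤ ∑ a, G.cfrPolicy (G.observations path rew ω) t h x a * G.estBound h x :=
          sum_le_sum fun a _ => mul_le_mul_of_nonneg_left (hω h hh x t ht a).2 (hs.1 a)
      _ = _ := by rw [← sum_mul, hs.2, one_mul]
  have e1 := fun a => measure_sum_gt_le (𝓕 := 𝓕) (fun t ht => hp.measurable_lossEst ht hh x a) hK
    (fun t ht => hp.ae_lossEst_mem.mono fun ω hω => hω h hh x t ht a)
    (fun t ht => hp.condExp_lossEst ht hh x a) hη hη1 ι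
  have e2 := measure_sum_gt_le (𝓕 := 𝓕) m1 hK b1
    (fun t ht => hp.condExp_sum_policy_mul_lossEst ht hh x) hη hη1 ι
  have e3 := measure_sum_lt_le (𝓕 := 𝓕) m1 hK b1
    (fun t ht => hp.condExp_sum_policy_mul_lossEst ht hh x) hη hη1 ι
  have hsub : {ω | ¬ Concentrates G T (G.observations path rew ω) (fun t => ν t ω) η ι h x} ⊆
      ((⋃ a ∈ (univ : Finset A), {ω | (1 + η) * ∑ t ∈ range T,
          G.cfLoss (G.cfrPolicy (G.observations path rew ω) t) (ν t ω) h x a +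
            G.estBound h x * ι / η < ∑ t ∈ range T,
          G.lossEst (G.observations path rew ω t h) h x a}) ∪
        {ω | (1 + η) * ∑ t ∈ range T, ∑ a, G.cfrPolicy (G.observations path rew ω) t h x a *
          G.cfLoss (G.cfrPolicy (G.observations path rew ω) t) (ν t ω) h x a +
            G.estBound h x * ι / η < ∑ t ∈ range T, ∑ a,
          G.cfrPolicy (G.observations path rew ω) t h x a *
            G.lossEst (G.observations path rew ω t h) h x a}) ∪
        {ω | ∑ t ∈ range T, ∑ a, G.cfrPolicy (G.observations path rew ω) t h x a *
            G.lossEst (G.observations path rew ω t h) h x a <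
          (1 - η) * ∑ t ∈ range T, ∑ a, G.cfrPolicy (G.observations path rew ω) t h x a *
            G.cfLoss (G.cfrPolicy (G.observations path rew ω) t) (ν t ω) h x a -
              G.estBound h x * ι / η} := by
    intro ω hω
    rw [Set.mem_ofPred_eq, Concentrates, not_and_or, not_and_or, not_forall] at hω
    rcases hω with ⟨a, ha⟩ | h1 | h1
    · exact Or.inl (Or.inl (Set.mem_biUnion (mem_coe.2 (mem_univ a)) (not_le.1 ha)))
    · exact Or.inl (Or.inr (not_le.1 h1))
    · exact Or.inr (not_le.1 h1)
  refine (measure_mono hsub).trans ?_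
  refine (measure_union_le _ _).trans ?_
  refine (add_le_add ((measure_union_le _ _).trans (add_le_add
    ((measure_biUnion_finset_le _ _).trans (sum_le_sum fun a _ => e1 a)) e2)) e3).trans ?_
  rw [sum_const, nsmul_eq_mul, card_univ, ← ENNReal.ofReal_natCast,
    ← ENNReal.ofReal_mul (Nat.cast_nonneg _), ← ENNReal.ofReal_add (by positivity) (by positivity),
    ← ENNReal.ofReal_add (by positivity) (by positivity)]
  exact ENNReal.ofReal_le_ofReal (by linarith)

lemma measure_exists_not_concentrates_le [Nonempty A] [Nonempty B]
    (hp : G.IsCFRPlay P T 𝓕 ν path rew) {η : ℝ} (hη : 0 < η) (hη1 : η ≤ 1) (ι : ℝ) :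
    P {ω | ¬ ∀ h < H, ∀ x : X h,
        Concentrates G T (G.observations path rew ω) (fun t => ν t ω) η ι h x} ≤
      ENNReal.ofReal (G.numInfosets * ((Fintype.card A + 2) * Real.exp (-ι))) := by
  have hsub : {ω | ¬ ∀ h < H, ∀ x : X h,
        Concentrates G T (G.observations path rew ω) (fun t => ν t ω) η ι h x} ⊆
      ⋃ h ∈ range H, ⋃ x ∈ (univ : Finset (X h)),
        {ω | ¬ Concentrates G T (G.observations path rew ω) (fun t => ν t ω) η ι h x} := by
    intro ω hω
    rw [Set.mem_ofPred_eq] at hω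
    push Not at hω
    obtain ⟨h, hh, x, hx⟩ := hω
    simp only [Set.mem_iUnion]
    exact ⟨h, mem_range.2 hh, x, mem_univ x, hx⟩
  refine (measure_mono hsub).trans ((measure_biUnion_finset_le _ _).trans ?_)
  refine (sum_le_sum fun h hh => (measure_biUnion_finset_le _ _).trans (sum_le_sum fun x _ =>
    hp.measure_not_concentrates_le hη hη1 ι (mem_range.1 hh) x)).trans_eq ?_
  simp only [sum_const, nsmul_eq_mul, card_univ]
  rw [← sum_mul, ENNReal.ofReal_mul (Nat.cast_nonneg _), ENNReal.ofReal_natCast, numInfosets]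
  simp

end POMG.IsCFRPlay

/-! ### Tuning and the high-probability bound -/

lemma POMG.numInfosets_pos {H : ℕ} {S X Y : ℕ → Type*} {A B : Type*} [∀ h, Fintype (S h)]
    [∀ h, Fintype (X h)] (G : POMG H S X Y A B) (hH : 0 < H) : 0 < G.numInfosets := by
  obtain ⟨s, -, -⟩ := exists_ne_zero_of_sum_ne_zero (G.init_mem.2.trans_ne one_ne_zero)
  have : Nonempty (X 0) := ⟨G.obsX 0 s⟩
  exact lt_of_lt_of_le Fintype.card_pos
    (single_le_sum (f := fun h => Fintype.card (X h)) (fun _ _ => Nat.zero_le _) (mem_range.2 hH))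

/-- With high probability, the regret of Balanced CFR with Regret Matching is at most
`8 √(H³XA²Tι)`. -/
theorem POMG.IsCFRPlay.regret_le {H : ℕ} {S X Y : ℕ → Type*} {A B : Type*} [∀ h, Fintype (S h)]
    [∀ h, Fintype (X h)] [Fintype A] [Fintype B] [Nonempty A] [Nonempty B] {Ω : Type*}
    [mΩ : MeasurableSpace Ω] {P : Measure Ω} [IsProbabilityMeasure P] {T : ℕ} {G : POMG H S X Y A B}
    {𝓕 : Filtration ℕ mΩ} {ν : ℕ → Ω → Strategy Y B} {path : ℕ → ℕ → Ω → StatePath H S A B}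
    {rew : ℕ → ℕ → Ω → Fin H → ℝ} (hp : G.IsCFRPlay P T 𝓕 ν path rew) {δ : ℝ} (hδ : 0 < δ)
    (hδ1 : δ < 1) :
    ENNReal.ofReal (1 - δ) ≤ P {ω | ∀ μ' : Strategy X A, IsPolicy H μ' →
      ∑ t ∈ range T, (G.pairing (G.cfrPolicy (G.observations path rew ω) t) (G.loss (ν t ω)) -
        G.pairing μ' (G.loss (ν t ω))) ≤
      8 * √((H : ℝ) ^ 3 * G.numInfosets * (Fintype.card A : ℝ) ^ 2 * T *
        Real.log (10 * G.numInfosets * Fintype.card A / δ))} := by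
  set ι := Real.log (10 * G.numInfosets * Fintype.card A / δ) with hι
  set b := √((H : ℝ) ^ 3 * G.numInfosets * (Fintype.card A : ℝ) ^ 2 * T * ι) with hb
  have hb0 : 0 ≤ b := Real.sqrt_nonneg _
  -- The regret never exceeds `H T`, so only `b < H T` needs an argument. This also excludes `H = 0`
  -- and `T = 0` and gives `η ≤ 1` below.
  by_cases htriv : (H : ℝ) * T ≤ b
  · have : {ω | ∀ μ' : Strategy X A, IsPolicy H μ' → ∑ t ∈ range T,
        (G.pairing (G.cfrPolicy (G.observations path rew ω) t) (G.loss (ν t ω)) -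
          G.pairing μ' (G.loss (ν t ω))) ≤ 8 * b} = Set.univ := by
      refine Set.eq_univ_of_forall fun ω μ' hμ' => ?_
      calc _ ≤ ∑ t ∈ range T, (H : ℝ) := sum_le_sum fun t ht => by
            have h1 := G.pairing_loss_le (G.isPolicy_cfrPolicy (G.observations path rew ω) t)
              (hp.isPolicy t (mem_range.1 ht) ω)
            have h2 := G.pairing_loss_nonneg hμ' (hp.isPolicy t (mem_range.1 ht) ω)
            linarith
        _ = H * T := by simp [mul_comm]
        _ ≤ 8 * b := by linarith
    rw [this, measure_univ]
    exact ENNReal.ofReal_le_one.2 (by linarith)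
  push Not at htriv
  have hHT : (0 : ℝ) < H * T := hb0.trans_lt htriv
  have hH0 : 0 < H := Nat.pos_of_ne_zero fun e => by simp [e] at hHT
  have hT0 : 0 < T := Nat.pos_of_ne_zero fun e => by simp [e] at hHT
  have hH : (1 : ℝ) ≤ H := Nat.one_le_cast.2 hH0
  have hT : (1 : ℝ) ≤ T := Nat.one_le_cast.2 hT0
  have hX : (1 : ℝ) ≤ G.numInfosets := Nat.one_le_cast.2 (G.numInfosets_pos hH0)
  have hA : (1 : ℝ) ≤ Fintype.card A := Nat.one_le_cast.2 Fintype.card_pos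
  have hXA : 1 ≤ (G.numInfosets : ℝ) * Fintype.card A := one_le_mul_of_one_le_of_one_le hX hA
  have hι1 : 1 ≤ ι := by
    rw [hι, Real.le_log_iff_exp_le (by positivity), le_div_iff₀ hδ]
    have := Real.exp_one_lt_d9
    nlinarith
  have hexp : Real.exp (-ι) = δ / (10 * G.numInfosets * Fintype.card A) := by
    rw [Real.exp_neg, hι, Real.exp_log (by positivity), inv_div]
  set η := b / ((H : ℝ) ^ 2 * T) with hη
  have hbpos : 0 < b := by rw [hb]; positivity
  have hη0 : 0 < η := by positivity
  have hη1 : η ≤ 1 := by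
    rw [hη, div_le_one (by positivity)]
    nlinarith
  have hbad := hp.measure_exists_not_concentrates_le hη0 hη1 ι
  -- The constant `10` in `ι` enters through `A + 2 ≤ 10 A` here and through `e < 10` in `1 ≤ ι`.
  have hbad' : (G.numInfosets : ℝ) * ((Fintype.card A + 2) * Real.exp (-ι)) ≤ δ := by
    rw [hexp, ← mul_assoc, mul_div_assoc', div_le_iff₀ (by positivity)]
    calc (G.numInfosets : ℝ) * (Fintype.card A + 2) * δ ≤
          G.numInfosets * (10 * Fintype.card A) * δ := by gcongr; linarith
      _ = _ := by ring
  set Good := {ω | ∀ μ' : Strategy X A, IsPolicy H μ' →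
      ∑ t ∈ range T, (G.pairing (G.cfrPolicy (G.observations path rew ω) t) (G.loss (ν t ω)) -
        G.pairing μ' (G.loss (ν t ω))) ≤ 8 * b} with hGood
  have hcompl : P Goodᶜ ≤ ENNReal.ofReal δ := by
    refine le_trans (measure_mono_ae ?_) (hbad.trans (ENNReal.ofReal_le_ofReal hbad'))
    filter_upwards [hp.ae_lossEst_mem] with ω hω hnot hc
    refine hnot fun μ' hμ' => ?_
    refine (G.regret_le_of_concentration (ν := fun t => ν t ω)
      (fun t ht => hp.isPolicy t ht ω) hη0 hη1 (zero_le_one.trans hι1) hω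
      (fun h hh x => (hc h hh x).1) (fun h hh x => (hc h hh x).2.1)
      (fun h hh x => (hc h hh x).2.2) hμ').trans ?_
    exact tuned_bound_le hH hX hA hT hι1 hb hη hη1
  -- Subadditivity holds for arbitrary sets, so the measurability of `Good`, defined by all
  -- comparators at once, is not needed.
  have h1 : 1 ≤ P Good + P Goodᶜ := by
    rw [← measure_univ (μ := P), ← Set.union_compl_self Good]
    exact measure_union_le _ _
  rw [ENNReal.ofReal_sub _ hδ.le, ENNReal.ofReal_one]
  exact tsub_le_iff_right.2 (h1.trans (by gcongr))

theorem theorem7 :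
    ∃ C : ℝ, 0 < C ∧
      ∀ (H : ℕ) (S X Y : ℕ → Type*) (A B : Type*) [∀ h, Fintype (S h)] [∀ h, Fintype (X h)]
        [Fintype A] [Fintype B] [Nonempty A] [Nonempty B] (G : POMG H S X Y A B)
        (Ω : Type*) [mΩ : MeasurableSpace Ω] (P : Measure Ω) [IsProbabilityMeasure P]
        (𝓕 : Filtration ℕ mΩ) (T : ℕ) (ν : ℕ → Ω → Strategy Y B)
        (path : ℕ → ℕ → Ω → StatePath H S A B) (rew : ℕ → ℕ → Ω → Fin H → ℝ) (δ : ℝ),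
        0 < δ → δ < 1 →
        G.IsCFRPlay P T 𝓕 ν path rew →
        -- with probability at least `1 - δ`, the largest "regret" is at most `C √(H³XA²Tι)`
        ENNReal.ofReal (1 - δ) ≤
          P {ω | ∀ μ' : Strategy X A, IsPolicy H μ' →
            ∑ t ∈ Finset.range T,
              (G.pairing (G.cfrPolicy (G.observations path rew ω) t) (G.loss (ν t ω)) -
                G.pairing μ' (G.loss (ν t ω))) ≤
            C * √((H : ℝ) ^ 3 * (G.numInfosets : ℝ) * (Fintype.card A : ℝ) ^ 2 * (T : ℝ) *
              Real.log (10 * (G.numInfosets : ℝ) * (Fintype.card A : ℝ) / δ))} ∧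
        -- each round plays `H` episodes, so that `H * T` episodes are played in total
        ∀ ω,
          (∀ t < T, (G.roundPolicies
            (G.cfrPolicy (G.observations path rew ω) t)).length = H) ∧
          (G.playedPolicies (G.observations path rew ω) T).length = H * T := by
  refine ⟨8, by norm_num, ?_⟩
  intro H S X Y A B _ _ _ _ _ _ G Ω mΩ P _ 𝓕 T ν path rew δ hδ hδ1 hp
  refine ⟨hp.regret_le hδ hδ1, fun ω => ⟨fun t _ => by simp [POMG.roundPolicies], ?_⟩⟩
  simp [POMG.playedPolicies, POMG.roundPolicies, List.length_flatMap, mul_comm]
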